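/- **Setting.** Let $D\subset\mathbb R^d$ be a nonempty bounded open set (for instance a bounded Lipschitz domain), $T>0$, $Q_T=D\times(0,T)$. For $R,M>0$ let $U_{0,R}$ be the set of continuous $u_0:D\to\mathbb R$ with $\|u_0\|_{L^\infty(D)}\le R$, and $U_M$ the set of continuous $u:D\times[0,T]\to\mathbb R$ with $\|u\|_{L^\infty(Q_T)}\le M$. Let $\Omega_{\rm eq}$ be a class of pairs $\omega=(A,F)$, where $-A$ generates a $C_0$-semigroup $S_A$ on $L^2(D)$ and $F:\mathbb R\to\mathbb R$, $F(0)=0$, and let $\mathcal T_{\omega,u_0}[v](t)=S_A(t)u_0+\int_0^tS_A(t-\tau)F(v(\tau))\,d\tau$. Assume that there are $\delta\in(0,1)$ and $C_S>0$ such that for all $\omega\in\Omega_{\rm eq}$, $u_0,v_0\in U_{0,R}$, $u,v\in U_M$: $\mathcal T_{\omega,u_0}$ maps $U_M$ to $U_M$, $\|\mathcal T_{\omega,u_0}[u]-\mathcal T_{\omega,u_0}[v]\|_{L^\infty(Q_T)}\le\delta\|u-v\|_{L^\infty(Q_T)}$ and $\|\mathcal T_{\omega,u_0}[u]-\mathcal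 T_{\omega,v_0}[u]\|_{L^\infty(Q_T)}\le C_S\|u_0-v_0\|_{L^\infty(D)}$. Let $\mathcal G_\omega(u_0)\in U_M$ be the fixed point of $\mathcal T_{\omega,u_0}$ and $\mathcal G_*=\mathcal G_{\omega_*}$ with $\omega_*\in\Omega_{\rm eq}$. Let $s_0>d/2$, let $U_0$ be the closed ball of radius $R_0$ in $H^{s_0}(D)$ (continuous representatives), with $R_0$ such that $U_0\subset U_{0,R}$, let $\Pi$ be a Borel probability measure on $U_0$ and $\mu$ one on $Q_T$. Put $$L[\Gamma]=\mathbb E_{u_0\sim\Pi,\,z\sim\mu}|\Gamma(u_0)(z)-\mathcal G_*(u_0)(z)|^2 .$$ Given $n\ge1$ i.i.d. blocks $(u_{0,i},z_{i,1},\dots,z_{i,q})\sim\Pi\otimes\mu^{\otimes q}$, $q\ge1$, let $\widehat L[\Gamma]=\frac1n\sum_i\frac1q\sum_j\bigl(\mathrm{clip}\,\Gamma(u_{0,i})(z_{i,j})-\mathrm{clip}\,\mathcal G_*(u_{0,i})(z_{i,j})\bigr)^2$, where $\mathrm{clip}$ is the truncation to $[-M,M]$. *Full information.* Let $\mathcal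 B_\ell=\{b_{\omega,\ell}:\omega\in\Omega_{\rm eq}\}$, $b_{\omega,\ell}(v,z)=(\mathcal T^{[\ell]}_{\omega,v}[0])(z)$. Let $\mathrm{embed}$ be any map from $\mathcal B_\ell$ to a set of measurable operators $U_0\to U_M$, $\varepsilon_{\rm imp}=\sup_{b\in\mathcal B_\ell}|L[\mathrm{embed}\,b]-L[b]|$, and $\widehat\Gamma_\ell=\mathrm{embed}(\widehat b_\ell)$ with $\widehat b_\ell\in\arg\min_{\mathcal B_\ell}\widehat L$. *Finite observations.* For each $m$ let $\xi_1,\dots,\xi_m\in D$, $P_mu_0=(u_0(\xi_1),\dots,u_0(\xi_m))$, and let $\mathcal E_m$ be a class of measurable maps $E:\mathbb R^m\to U_0$. Let $\varepsilon_{\rm rec}^2(m)=\inf_{E\in\mathcal E_m}\mathbb E_{u_0\sim\Pi}\|E(P_mu_0)-u_0\|_{L^\infty(D)}^2$ and $\mathcal B_{m,\ell}=\{b_{\omega,E,\ell}:\omega\in\Omega_{\rm eq},E\in\mathcal E_m\}$, $b_{\omega,E,\ell}(a,z)=(\mathcal T^{[\ell]}_{\omega,E(a)}[0])(z)$. For $\Gamma_m:\mathbb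 R^m\times Q_T\to\mathbb R$ let $L_m[\Gamma_m]$ and $\widehat L_m[\Gamma_m]$ be $L$ and $\widehat L$ of $u_0\mapsto\Gamma_m(P_mu_0,\cdot)$. Let $\mathrm{embed}_m$ be any map from $\mathcal B_{m,\ell}$ to a set of measurable functions $\mathbb R^m\times Q_T\to[-M,M]$, $\varepsilon_{\rm imp}^m=\sup_{b\in\mathcal B_{m,\ell}}|L_m[\mathrm{embed}_mb]-L_m[b]|$, and $\widehat\Gamma_{m,\ell}=\mathrm{embed}_m(\widehat b_{m,\ell})$ with $\widehat b_{m,\ell}\in\arg\min_{\mathcal B_{m,\ell}}\widehat L_m$. *Entropies.* Let $\mathcal H_\Omega,\mathcal H_m$ be real functions with $\log N(\Omega_{\rm eq},d_\Omega,\varepsilon)\le\mathcal H_\Omega(\varepsilon)$ and $\log N(\mathcal E_m,d_m,\varepsilon)\le\mathcal H_m(\varepsilon)$ for all $\varepsilon>0$ (covering numbers with centers in the class), where $d_\Omega(\omega,\omega')=\sup_{u_0\in U_{0,R}}\sup_{u\in U_M}\|\mathcal T_{\omega,u_0}[u]-\mathcal T_{\omega',u_0}[u]\|_{L^\infty(Q_T)}$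 and $d_m(E,E')=\sup_{a\in P_m(U_0)}\|E(a)-E'(a)\|_{L^\infty(D)}$. For a fixed $c>0$ put $$\mathcal I_\Omega=\int_0^{2M}\sqrt{\mathcal H_\Omega(c(1-\delta)\varepsilon)}\,d\varepsilon,\qquad \mathcal I_{\Omega,m}=\int_0^{2M}\sqrt{\mathcal H_\Omega(c(1-\delta)\varepsilon)+\mathcal H_m(c(1-\delta)\varepsilon/C_S)}\,d\varepsilon .$$ **Corollary 5.3.** Let $\ell_n=\lceil\log n/(4|\log\delta|)\rceil$. (i) There is a constant $C$ depending only on $c$ and $\delta$ such that, if $\mathcal I_\Omega<\infty$, then for all $n,q\ge1$ and $0<\rho<1$, with probability at least $1-\rho$, every choice of the minimizer satisfies $$L[\widehat\Gamma_{\ell_n}]\le\varepsilon_{\rm imp}+C\left(\frac{M^2}{\sqrt n}+\frac{M\,\mathcal I_\Omega}{\sqrt n}+M^2\sqrt{\frac{\log(1/\rho)}n}\right).$$ (ii) Suppose that for some $C_I>0$, $\alpha\ge0$, $\beta>0$ and $C_{\rm rec}$ one has $\mathcal I_{\Omega,m}\le C_Im^\alpha$ and $\varepsilon_{\rm rec}^2(m)\le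 C_{\rm rec}^2m^{-2\beta}$ for all $m\ge1$, and that $\kappa_1n^{1/(2(2\beta+\alpha))}\le m_n\le\kappa_2n^{1/(2(2\beta+\alpha))}$ for all $n\ge1$, with $\kappa_1>0$. Then there is a constant $C$ depending only on $c,M,C_S,\delta,C_{\rm rec},C_I,\alpha,\beta,\kappa_1,\kappa_2$ such that for all $n,q\ge1$ and $0<\rho<1$, with probability at least $1-\rho$, every choice of the minimizer satisfies $$L_{m_n}[\widehat\Gamma_{m_n,\ell_n}]\le\varepsilon_{\rm imp}^{m_n}+C\left(n^{-\beta/(2\beta+\alpha)}+M^2\sqrt{\frac{\log(1/\rho)}n}\right).$$ -/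

import Mathlib

open Set Filter Topology MeasureTheory
open scoped NNReal ENNReal BoundedContinuousFunction SchwartzMap

noncomputable section

namespace PicardLearning

/-- Spaces of bounded continuous functions carry the Borel σ-algebra of the sup norm. -/
instance instMeasurableSpaceBCF {X : Type*} [TopologicalSpace X] : MeasurableSpace (X →ᵇ ℝ) :=
  borel _

instance instBorelSpaceBCF {X : Type*} [TopologicalSpace X] : BorelSpace (X →ᵇ ℝ) := ⟨rfl⟩

/-! ### Semigroups and equation specifications -/

/-- A strongly continuous one-parameter semigroup of bounded operators. -/
structure C0Semigroup (H : Type*) [NormedAddCommGroup H] [NormedSpace ℝ H] where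
  op : ℝ≥0 → H →L[ℝ] H
  op_zero : op 0 = ContinuousLinearMap.id ℝ H
  op_add : ∀ s t, op (s + t) = (op s).comp (op t)
  tendsto_zero : ∀ x, Tendsto (fun t => op t x) (𝓝 0) (𝓝 x)

/-- `S` is the semigroup `exp (-tA)`: the domain of the (unbounded) operator `A` consists of the
`x` for which `(x - S t x) / t` converges as `t ↓ 0`, and `A x` is the limit. -/
def C0Semigroup.IsGeneratedBy {H : Type*} [NormedAddCommGroup H] [NormedSpace ℝ H]
    (S : C0Semigroup H) (A : H →ₗ.[ℝ] H) : Prop :=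
  ∀ x y, (x, y) ∈ A.graph ↔
    Tendsto (fun t : ℝ≥0 => (t : ℝ)⁻¹ • (x - S.op t x)) (𝓝[>] 0) (𝓝 y)

/-- The ambient space `ℝᵈ`. -/
abbrev Space (d : ℕ) : Type := EuclideanSpace ℝ (Fin d)

/-- Lebesgue measure on `D`. -/
abbrev volOn {d : ℕ} (D : Set (Space d)) : Measure D := (volume : Measure (Space d)).comap (↑)

/-- `L²(D)`. -/
abbrev L2 {d : ℕ} (D : Set (Space d)) : Type := Lp ℝ 2 (volOn D)

/-- An equation specification `ω = (A, F)` for `∂ₜ u + A u = F(u)` on `D`, together with the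
semigroup `S_A` on `L²(D)`, which is determined by `A`. -/
structure EquationSpec {d : ℕ} (D : Set (Space d)) where
  A : L2 D →ₗ.[ℝ] L2 D
  F : ℝ → ℝ
  F_zero : F 0 = 0
  semigroup : C0Semigroup (L2 D)
  generated : semigroup.IsGeneratedBy A

/-! ### The Picard map -/

/-- Bounded continuous functions on `D`; the norm is the `L^∞(D)` norm. The space of initial data
`U_{0,R}` is the closed ball of radius `R`. -/
abbrev InitialFun {d : ℕ} (D : Set (Space d)) : Type := D →ᵇ ℝ

/-- Bounded continuous functions on `D × [0,T]`; the norm is the `L^∞(Q_T)` norm. The solution space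
`U_M` is the closed ball of radius `M`. -/
abbrev SpaceTimeFun {d : ℕ} (D : Set (Space d)) (T : ℝ) : Type := (D × Icc (0 : ℝ) T) →ᵇ ℝ

/-- The open cylinder `Q_T = D × (0,T)` of query points. -/
abbrev Cylinder {d : ℕ} (D : Set (Space d)) (T : ℝ) : Type := D × Ioo (0 : ℝ) T

/-- The value `u(z)` at a query point `z ∈ Q_T`. -/
def SpaceTimeFun.eval {d : ℕ} {D : Set (Space d)} {T : ℝ} (u : SpaceTimeFun D T)
    (z : Cylinder D T) : ℝ :=
  u (z.1, ⟨z.2, Ioo_subset_Icc_self z.2.2⟩)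

/-- `w(t) = S_A(t) u₀ + ∫₀ᵗ S_A(t-τ) F(v(τ)) dτ` in `L²(D)` for every `t ∈ [0,T]`, the integral being
a convergent Bochner integral. Here `f₀` and `g τ` are the classes of `u₀` and of `F(v(τ))`. -/
def IsPicardImage {d : ℕ} {D : Set (Space d)} {T : ℝ} (ω : EquationSpec D)
    (u₀ : InitialFun D) (v w : SpaceTimeFun D T) : Prop :=
  ∃ (f₀ : L2 D) (g : ℝ → L2 D),
    (∀ᵐ x ∂volOn D, f₀ x = u₀ x) ∧
    (∀ τ : Icc (0 : ℝ) T, ∀ᵐ x ∂volOn D, g τ x = ω.F (v (x, τ))) ∧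
    ∀ t : Icc (0 : ℝ) T,
      IntervalIntegrable (fun τ => ω.semigroup.op (t - τ).toNNReal (g τ)) volume 0 t ∧
      ∀ᵐ x ∂volOn D, (ω.semigroup.op (t : ℝ).toNNReal f₀ +
        ∫ τ in (0 : ℝ)..t, ω.semigroup.op (t - τ).toNNReal (g τ) : L2 D) x = w (x, t)

open Classical in
/-- The Picard map `𝒯_{ω,u₀}` (with value `0` where the Picard image is not a bounded continuous
function). -/
def picardMap {d : ℕ} {D : Set (Space d)} {T : ℝ} (ω : EquationSpec D)
    (u₀ : InitialFun D) (v : SpaceTimeFun D T) : SpaceTimeFun D T :=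
  if h : ∃ w, IsPicardImage ω u₀ v w then h.choose else 0

/-- The uniform contraction assumption on the class `Ω` of admissible equations: for `ω ∈ Ω` and
`u₀ ∈ U_{0,R}` the Picard map is well defined from `U_M` to `U_M` and `δ`-contractive, and it is
`C_S`-Lipschitz in the initial datum. -/
structure UniformContraction {d : ℕ} {D : Set (Space d)} (T R M C_S δ : ℝ)
    (Ω : Set (EquationSpec D)) : Prop where
  maps : ∀ ω ∈ Ω, ∀ u₀ : InitialFun D, ‖u₀‖ ≤ R → ∀ v : SpaceTimeFun D T, ‖v‖ ≤ M →
    ∃ w : SpaceTimeFun D T, ‖w‖ ≤ M ∧ IsPicardImage ω u₀ v w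
  contraction : ∀ ω ∈ Ω, ∀ u₀ : InitialFun D, ‖u₀‖ ≤ R →
    ∀ u v : SpaceTimeFun D T, ‖u‖ ≤ M → ‖v‖ ≤ M →
      ‖picardMap ω u₀ u - picardMap ω u₀ v‖ ≤ δ * ‖u - v‖
  lipschitz : ∀ ω ∈ Ω, ∀ u₀ v₀ : InitialFun D, ‖u₀‖ ≤ R → ‖v₀‖ ≤ R →
    ∀ u : SpaceTimeFun D T, ‖u‖ ≤ M →
      ‖picardMap ω u₀ u - picardMap ω v₀ u‖ ≤ C_S * ‖u₀ - v₀‖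

open Classical in
/-- The solution operator `𝒢_ω`: the mild solution in `U_M`, i.e. the `u ∈ U_M` with
`u(t) = S_A(t) u₀ + ∫₀ᵗ S_A(t-τ) F(u(τ)) dτ` (it exists and is unique for `u₀ ∈ U_{0,R}` under the
contraction assumption). -/
def solutionOperator {d : ℕ} {D : Set (Space d)} (T M : ℝ) (ω : EquationSpec D)
    (u₀ : InitialFun D) : SpaceTimeFun D T :=
  if h : ∃ u : SpaceTimeFun D T, ‖u‖ ≤ M ∧ IsPicardImage ω u₀ u u then h.choose else 0

/-! ### The Sobolev ball -/

/-- The norm of `v` in `Hˢ(D)`, as the infimum of the `Hˢ(ℝᵈ)` norms `‖(1 + |ξ|²)^{s/2} 𝓕f‖_{L²}` over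
the extensions `f` of `v` (it is `∞` if `v` is not in `Hˢ(D)`). By Plancherel the norm of `f` is the
`L²` norm of its Bessel potential `g` of order `s`. -/
def sobolevENorm {d : ℕ} {D : Set (Space d)} (s : ℝ) (v : InitialFun D) : ℝ≥0∞ :=
  ⨅ (f : Lp ℂ 2 (volume : Measure (Space d))) (g : Lp ℂ 2 (volume : Measure (Space d)))
    (_ : ∀ᵐ x ∂volOn D, f x.1 = (v x : ℂ))
    (_ : TemperedDistribution.besselPotential (Space d) ℂ s (f : 𝓢'(Space d, ℂ)) = g), ‖g‖ₑ

/-- `U₀ = {v ∈ Hˢ(D) : ‖v‖ ≤ R₀}`, each element being taken as its continuous representative. -/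
def sobolevBall {d : ℕ} (D : Set (Space d)) (s R₀ : ℝ) : Set (InitialFun D) :=
  {v | sobolevENorm s v ≤ ENNReal.ofReal R₀}

/-! ### The learning setting -/

/-- The setting: a bounded domain, a class `Ω` of admissible equations subject to the contraction
assumption, the true equation `ωstar ∈ Ω`, the law `Pi` of the initial data on the Sobolev ball, and
the law `mu` of the query points. -/
structure Setting (M C_S δ : ℝ) where
  d : ℕ
  D : Set (Space d)
  isOpen_D : IsOpen D
  bounded_D : Bornology.IsBounded D
  nonempty_D : D.Nonempty
  T : ℝ
  T_pos : 0 < T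
  R : ℝ
  R_pos : 0 < R
  s₀ : ℝ
  s₀_gt : (d : ℝ) / 2 < s₀
  R₀ : ℝ
  ball_subset : sobolevBall D s₀ R₀ ⊆ Metric.closedBall 0 R
  Ω : Set (EquationSpec D)
  contraction : UniformContraction T R M C_S δ Ω
  ωstar : EquationSpec D
  ωstar_mem : ωstar ∈ Ω
  Pi : Measure (sobolevBall D s₀ R₀)
  isProb_Pi : IsProbabilityMeasure Pi
  mu : Measure (Cylinder D T)
  isProb_mu : IsProbabilityMeasure mu

namespace Setting

variable {M C_S δ : ℝ} (P : Setting M C_S δ)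

/-- `U₀`. -/
abbrev U0 : Type := sobolevBall P.D P.s₀ P.R₀

/-- `U_{0,R}`. -/
abbrev U0R : Type := Metric.closedBall (0 : InitialFun P.D) P.R

/-- `U_M`. -/
abbrev UM : Type := Metric.closedBall (0 : SpaceTimeFun P.D P.T) M

/-- `Q_T`. -/
abbrev Q : Type := Cylinder P.D P.T

/-- The inclusion `U₀ ⊆ U_{0,R}`. -/
def incl (u : P.U0) : P.U0R := ⟨u.1, P.ball_subset u.2⟩

/-- The value `𝒢_*(u₀)(z)` of the target solution operator. -/
def target (u : P.U0) (z : P.Q) : ℝ := (solutionOperator P.T M P.ωstar u.1).eval z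

/-- The transition `f_ω(v,z,u) = (v,z,𝒯_{ω,v}[u])`. -/
def step (ω : EquationSpec P.D) (x : P.U0R × P.Q × SpaceTimeFun P.D P.T) :
    P.U0R × P.Q × SpaceTimeFun P.D P.T :=
  (x.1, x.2.1, picardMap ω x.1.1 x.2.2)

/-- The `ℓ`-step Picard transition model `b_{ω,ℓ}(v,z) = (h ∘ f_ω^ℓ ∘ J)(v,z)`, with
`J(v,z) = (v,z,0)` and `h(v,z,u) = u(z)`. -/
def model (ω : EquationSpec P.D) (ℓ : ℕ) (v : P.U0R) (z : P.Q) : ℝ :=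
  let x := (P.step ω)^[ℓ] (v, z, 0)
  x.2.2.eval x.2.1

/-- The abstract Picard class `ℬ_ℓ`. -/
def picardClass (ℓ : ℕ) : Set (P.U0R → P.Q → ℝ) := {b | ∃ ω ∈ P.Ω, b = P.model ω ℓ}

/-- The population risk `E |Γ(u₀)(z) - 𝒢_*(u₀)(z)|²`. -/
def risk (Γ : P.U0 → P.Q → ℝ) : ℝ :=
  ∫ p, |Γ p.1 p.2 - P.target p.1 p.2| ^ 2 ∂(P.Pi.prod P.mu)

/-- The law of `n` independent trajectory blocks `(u₀, z₁, …, z_q) ∼ Π ⊗ μ^q`. -/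
def sampleLaw (n q : ℕ) : Measure (Fin n → P.U0 × (Fin q → P.Q)) :=
  Measure.pi fun _ => P.Pi.prod (Measure.pi fun _ => P.mu)

end Setting

/-- Clipping to `[-M,M]`. -/
def clip (M y : ℝ) : ℝ := max (-M) (min M y)

/-- The clipped squared loss. -/
def clippedLoss (M y y' : ℝ) : ℝ := (clip M y - clip M y') ^ 2

namespace Setting

variable {M C_S δ : ℝ} (P : Setting M C_S δ)

/-- The empirical risk `(1/n) ∑ᵢ (1/q) ∑ⱼ loss(Γ(u₀ᵢ)(zᵢⱼ), 𝒢_*(u₀ᵢ)(zᵢⱼ))`. -/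
def empiricalRisk {n q : ℕ} (S : Fin n → P.U0 × (Fin q → P.Q)) (Γ : P.U0 → P.Q → ℝ) : ℝ :=
  1 / (n : ℝ) * ∑ i, 1 / (q : ℝ) * ∑ j,
    clippedLoss M (Γ (S i).1 ((S i).2 j)) (P.target (S i).1 ((S i).2 j))

/-! ### Full information -/

/-- An abstract predictor `b` as a function of `u₀ ∈ U₀` and `z`. -/
def onU0 (b : P.U0R → P.Q → ℝ) (u : P.U0) (z : P.Q) : ℝ := b (P.incl u) z

/-- The values `Γ(u₀)(z)` of an operator model `Γ : U₀ → U_M`. -/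
def opEval (Γ : P.U0 → P.UM) (u : P.U0) (z : P.Q) : ℝ := (Γ u).1.eval z

/-- `b̂` minimizes the empirical risk over `ℬ_ℓ`. -/
def IsERM {n q : ℕ} (S : Fin n → P.U0 × (Fin q → P.Q)) {ℓ : ℕ} (bhat : P.picardClass ℓ) : Prop :=
  ∀ b : P.picardClass ℓ,
    P.empiricalRisk S (P.onU0 bhat.1) ≤ P.empiricalRisk S (P.onU0 b.1)

/-- The implementation error `ε_imp = sup_{b ∈ ℬ_ℓ} |L[embed b] - L[b]|`. -/
def impError {ℓ : ℕ} {𝔑 : Set (P.U0 → P.UM)} (embed : P.picardClass ℓ → 𝔑) : ℝ :=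
  ⨆ b : P.picardClass ℓ, |P.risk (P.opEval (embed b).1) - P.risk (P.onU0 b.1)|

end Setting

/-- The pseudometric `d_Ω(ω,ω') = sup_{u₀ ∈ U_{0,R}} sup_{u ∈ U_M} ‖𝒯_{ω,u₀}[u] - 𝒯_{ω',u₀}[u]‖`. -/
@[reducible] def specPseudoEMetric {d : ℕ} (D : Set (Space d)) (T R M : ℝ) :
    PseudoEMetricSpace (EquationSpec D) where
  edist ω ω' := ⨆ (u₀ : Metric.closedBall (0 : InitialFun D) R)
    (u : Metric.closedBall (0 : SpaceTimeFun D T) M),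
      edist (picardMap ω u₀.1 u.1) (picardMap ω' u₀.1 u.1)
  edist_self ω := by simp
  edist_comm ω ω' := by simp only [edist_comm]
  edist_triangle ω₁ ω₂ ω₃ := by
    refine iSup₂_le fun u₀ u => (edist_triangle _ (picardMap ω₂ u₀.1 u.1) _).trans ?_
    exact add_le_add
      (le_iSup₂ (f := fun (u₀ : Metric.closedBall (0 : InitialFun D) R)
        (u : Metric.closedBall (0 : SpaceTimeFun D T) M) =>
          edist (picardMap ω₁ u₀.1 u.1) (picardMap ω₂ u₀.1 u.1)) u₀ u)
      (le_iSup₂ (f := fun (u₀ : Metric.closedBall (0 : InitialFun D) R)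
        (u : Metric.closedBall (0 : SpaceTimeFun D T) M) =>
          edist (picardMap ω₂ u₀.1 u.1) (picardMap ω₃ u₀.1 u.1)) u₀ u)

namespace Setting

variable {M C_S δ : ℝ} (P : Setting M C_S δ)

/-- `log N(Ω, d_Ω, ε) ≤ H(ε)` for all `ε > 0`. -/
def SpecEntropyBound (H : ℝ → ℝ) : Prop :=
  letI := specPseudoEMetric P.D P.T P.R M
  ∀ ε : ℝ≥0, 0 < ε → Metric.coveringNumber ε P.Ω ≠ ⊤ ∧
    Real.log ((Metric.coveringNumber ε P.Ω).toNat : ℝ) ≤ H ε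

end Setting

/-- The full-information entropy integral `∫₀^{2M} √(H_Ω(c(1-δ)ε)) dε`. -/
def entropyIntegral (M δ c : ℝ) (H : ℝ → ℝ) : ℝ≥0∞ :=
  ∫⁻ ε in Ioc 0 (2 * M), ENNReal.ofReal (√(H (c * (1 - δ) * ε)))

/-- The finite-observation entropy integral
`∫₀^{2M} √(H_Ω(c(1-δ)ε) + H_ℰ(c(1-δ)ε/C_S)) dε`. -/
def entropyIntegralObs (M C_S δ c : ℝ) (H H' : ℝ → ℝ) : ℝ≥0∞ :=
  ∫⁻ ε in Ioc 0 (2 * M),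
    ENNReal.ofReal (√(H (c * (1 - δ) * ε) + H' (c * (1 - δ) * ε / C_S)))

/-! ### Finite observations -/

/-- Sensor locations `ξ₁, …, ξ_m ∈ D` and a class `ℰ_m` of measurable reconstruction maps
`ℝᵐ → U₀`, for every `m`. -/
structure Sensing {M C_S δ : ℝ} (P : Setting M C_S δ) where
  ξ : (m : ℕ) → Fin m → P.D
  recon : (m : ℕ) → Set ((Fin m → ℝ) → P.U0)
  measurable_recon : ∀ m, ∀ E ∈ recon m, Measurable E

namespace Sensing

variable {M C_S δ : ℝ} {P : Setting M C_S δ} (O : Sensing P)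

/-- The observation map `P_m u₀ = (u₀(ξ₁), …, u₀(ξ_m))`. -/
def obs (m : ℕ) (u : P.U0) : Fin m → ℝ := fun i => u.1 (O.ξ m i)

/-- The squared reconstruction error `inf_{E ∈ ℰ_m} E ‖E(P_m u₀) - u₀‖²`. -/
def recError (m : ℕ) : ℝ≥0∞ :=
  ⨅ E ∈ O.recon m, ∫⁻ u, ‖(E (O.obs m u)).1 - u.1‖ₑ ^ 2 ∂P.Pi

/-- The transition `f_{ω,E}(a,z,u) = (a,z,𝒯_{ω,E(a)}[u])`. -/
def step {m : ℕ} (ω : EquationSpec P.D) (E : (Fin m → ℝ) → P.U0)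
    (x : (Fin m → ℝ) × P.Q × SpaceTimeFun P.D P.T) :
    (Fin m → ℝ) × P.Q × SpaceTimeFun P.D P.T :=
  (x.1, x.2.1, picardMap ω (E x.1).1 x.2.2)

/-- The `ℓ`-step finite-observation model `b_{ω,E,ℓ}(a,z) = (𝒯_{ω,E(a)}^ℓ[0])(z)`. -/
def model {m : ℕ} (ω : EquationSpec P.D) (E : (Fin m → ℝ) → P.U0) (ℓ : ℕ)
    (a : Fin m → ℝ) (z : P.Q) : ℝ :=
  let x := (step ω E)^[ℓ] (a, z, 0)
  x.2.2.eval x.2.1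

/-- The abstract finite-observation Picard class `ℬ_{m,ℓ}`. -/
def picardClass (m ℓ : ℕ) : Set ((Fin m → ℝ) → P.Q → ℝ) :=
  {b | ∃ ω ∈ P.Ω, ∃ E ∈ O.recon m, b = model ω E ℓ}

/-- The lift `Γ_m^↑(u₀)(z) = Γ_m(P_m u₀, z)`. -/
def lift {m : ℕ} (Γ : (Fin m → ℝ) → P.Q → ℝ) (u : P.U0) (z : P.Q) : ℝ := Γ (O.obs m u) z

/-- The finite-observation risk `L_m[Γ_m] = E |Γ_m(P_m u₀, z) - 𝒢_*(u₀)(z)|²`. -/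
def risk {m : ℕ} (Γ : (Fin m → ℝ) → P.Q → ℝ) : ℝ := P.risk (O.lift Γ)

/-- `b̂` minimizes the empirical finite-observation risk over `ℬ_{m,ℓ}`. -/
def IsERM {n q : ℕ} (S : Fin n → P.U0 × (Fin q → P.Q)) {m ℓ : ℕ}
    (bhat : O.picardClass m ℓ) : Prop :=
  ∀ b : O.picardClass m ℓ,
    P.empiricalRisk S (O.lift bhat.1) ≤ P.empiricalRisk S (O.lift b.1)

/-- The implementation error `ε_imp^m = sup_{b ∈ ℬ_{m,ℓ}} |L_m[embed b] - L_m[b]|`. -/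
def impError {m ℓ : ℕ} {𝔑 : Set ((Fin m → ℝ) → P.Q → ℝ)}
    (embed : O.picardClass m ℓ → 𝔑) : ℝ :=
  ⨆ b : O.picardClass m ℓ, |O.risk (embed b).1 - O.risk b.1|

/-- The pseudometric `d_ℰ(E,E') = sup_{a ∈ P_m(U₀)} ‖E(a) - E'(a)‖_{L^∞(D)}`. -/
@[reducible] def reconPseudoEMetric (m : ℕ) : PseudoEMetricSpace ((Fin m → ℝ) → P.U0) where
  edist E E' := ⨆ u : P.U0, edist (E (O.obs m u)).1 (E' (O.obs m u)).1
  edist_self E := by simp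
  edist_comm E E' := by simp only [edist_comm]
  edist_triangle E₁ E₂ E₃ := by
    refine iSup_le fun u => (edist_triangle _ (E₂ (O.obs m u)).1 _).trans ?_
    exact add_le_add
      (le_iSup (fun u : P.U0 => edist (E₁ (O.obs m u)).1 (E₂ (O.obs m u)).1) u)
      (le_iSup (fun u : P.U0 => edist (E₂ (O.obs m u)).1 (E₃ (O.obs m u)).1) u)

/-- `log N(ℰ_m, d_ℰ, ε) ≤ H(ε)` for all `ε > 0`. -/
def ReconEntropyBound (m : ℕ) (H : ℝ → ℝ) : Prop :=
  letI := O.reconPseudoEMetric m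
  ∀ ε : ℝ≥0, 0 < ε → Metric.coveringNumber ε (O.recon m) ≠ ⊤ ∧
    Real.log ((Metric.coveringNumber ε (O.recon m)).toNat : ℝ) ≤ H ε

end Sensing

/-- The Picard depth `ℓ_n = ⌈log n / (4 |log δ|)⌉`. -/
def depth (δ : ℝ) (n : ℕ) : ℕ := ⌈Real.log n / (4 * |Real.log δ|)⌉₊

end PicardLearning

end

namespace PicardLearning

/-! ### Uniform deviation by chaining -/

/-! The risk of the empirical minimizer is a bias plus a stochastic term, and contraction controls
both. Started from `0`, `ℓ` Picard steps of the true equation miss the solution by at most `δ ^ ℓ *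
M`, and the depth makes the square of this at most `M ^ 2 / √n`. Moreover, changing the Picard map
by `ε` moves every iterate by at most `ε / (1 - δ)`, whatever the depth
(`UniformContraction.norm_iterate_sub_iterate_le`). Hence a cover of the equations, combined with
one of the reconstruction maps through the `C_S`-Lipschitz bound, is a sup-norm cover of the
predictors at any depth.

For the stochastic term only one-sided increments matter: if `b` has empirical risk at most that of
`b₀`, then risk(`b`) - risk(`b₀`) is at most deviation(`b`) - deviation(`b₀`)
(`Setting.exists_oracle_event`). Whole blocks serve as the i.i.d. sample points, so `q` does not
enter the rate. Predictors and target are bounded by `M`, so clipping is inactive and the block loss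
is `4 * M`-Lipschitz in the predictor. The increments are bounded by chaining that starts at `b₀`
itself: Hoeffding on each link, a union bound per level, and a dyadic comparison with the entropy
integral (`exists_uniform_deviation_event`). The good event involves finitely many net elements and
the remainder below the finest net is deterministic, so the class may be uncountable and all
minimizers are treated at once.

With finitely many sensors, `b₀` is the true equation with a nearly optimal reconstruction map. Its
risk carries the squared reconstruction error, and the prescribed number of sensors balances `m ^
(-2β)` against `m ^ α / √n`. -/

/-- The difference between the mean of `f` and its average over the sample `S`. -/
noncomputable def deviation {Z : Type*} [MeasurableSpace Z] (μ : Measure Z) {n : ℕ} (f : Z → ℝ)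
    (S : Fin n → Z) : ℝ :=
  ∫ z, f z ∂μ - 1 / (n : ℝ) * ∑ i, f (S i)

section Deviation

variable {Z : Type*} [MeasurableSpace Z] {μ : Measure Z} {n : ℕ}

lemma measurable_deviation {f : Z → ℝ} (hf : Measurable f) :
    Measurable (deviation μ f : (Fin n → Z) → ℝ) := by
  unfold deviation
  fun_prop

lemma deviation_sub {f g : Z → ℝ} (hf : Integrable f μ) (hg : Integrable g μ) (S : Fin n → Z) :
    deviation μ (fun z => f z - g z) S = deviation μ f S - deviation μ g S := by
  simp only [deviation, integral_sub hf hg, Finset.sum_sub_distrib]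
  ring

/-- A deterministic bound, valid for every sample; it disposes of the remainder below the finest
net. -/
lemma deviation_le [IsProbabilityMeasure μ] (hn : 1 ≤ n) {f : Z → ℝ} {η : ℝ}
    (hb : ∀ z, |f z| ≤ η) (S : Fin n → Z) : deviation μ f S ≤ 2 * η := by
  have hn' : (0 : ℝ) < n := by exact_mod_cast hn
  have h1 : ∫ z, f z ∂μ ≤ η := by
    have := norm_integral_le_of_norm_le_const (μ := μ) (f := f) (C := η) (ae_of_all _ hb)
    simp only [probReal_univ, mul_one] at this
    exact (le_abs_self _).trans this
  have h2 : -(n * η) ≤ ∑ i, f (S i) := by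
    calc -(n * η) = ∑ _i : Fin n, -η := by simp
      _ ≤ _ := Finset.sum_le_sum fun i _ => (abs_le.1 (hb _)).1
  have h3 : -η ≤ 1 / (n : ℝ) * ∑ i, f (S i) := by
    rw [one_div, ← div_eq_inv_mul, le_div_iff₀ hn']
    linarith
  unfold deviation
  linarith

/-- Hoeffding's inequality for the deviation of a bounded function. -/
lemma measure_deviation_ge_le [IsProbabilityMeasure μ] (hn : 1 ≤ n) {f : Z → ℝ}
    (hf : Measurable f) {η : ℝ} (hη : 0 < η) (hb : ∀ z, |f z| ≤ η) {u : ℝ} (hu : 0 ≤ u) :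
    (Measure.pi fun _ : Fin n => μ) {S | η * √(2 * u / n) ≤ deviation μ f S} ≤
      ENNReal.ofReal (Real.exp (-u)) := by
  have hn' : (0 : ℝ) < n := by exact_mod_cast hn
  -- The sign is flipped because the deviation is mean minus average, while the tail bound controls
  -- sums from above.
  have hsub : ∀ i ∈ (Finset.univ : Finset (Fin n)), ProbabilityTheory.HasSubgaussianMGF
      (fun S : Fin n → Z => -f (S i) - ∫ z, -f z ∂μ) ((‖η - -η‖₊ / 2) ^ 2)
      (Measure.pi fun _ : Fin n => μ) := by
    intro i _
    have h := ProbabilityTheory.hasSubgaussianMGF_of_mem_Icc (μ := Measure.pi fun _ : Fin n => μ)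
      (X := fun S : Fin n → Z => -f (S i)) (a := -η) (b := η)
      (hf.neg.comp (measurable_pi_apply i)).aemeasurable
      (ae_of_all _ fun S => by
        have := abs_le.1 (hb (S i))
        constructor <;> linarith [this.1, this.2])
    have he : ∫ S, -f (S i) ∂(Measure.pi fun _ : Fin n => μ) = ∫ z, -f z ∂μ := by
      have h1 := integral_map (μ := Measure.pi fun _ : Fin n => μ)
        (measurable_pi_apply i).aemeasurable (f := fun z => -f z) hf.neg.aestronglyMeasurable
      exact h1.symm.trans (by rw [show (fun S : Fin n → Z => S i) = Function.eval i from rfl,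
        (measurePreserving_eval (fun _ : Fin n => μ) i).map_eq])
    rw [he] at h
    exact h
  have hind : ProbabilityTheory.iIndepFun
      (fun (i : Fin n) (S : Fin n → Z) => -f (S i) - ∫ z, -f z ∂μ)
      (Measure.pi fun _ : Fin n => μ) :=
    ProbabilityTheory.iIndepFun_pi (μ := fun _ : Fin n => μ)
      (X := fun _ z => -f z - ∫ z, -f z ∂μ) fun i => by fun_prop
  have key := ProbabilityTheory.HasSubgaussianMGF.measure_sum_ge_le_of_iIndepFun hind hsub
    (ε := n * (η * √(2 * u / n))) (by positivity)
  have hset : {S : Fin n → Z | n * (η * √(2 * u / n)) ≤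
      ∑ i, (-f (S i) - ∫ z, -f z ∂μ)} = {S | η * √(2 * u / n) ≤ deviation μ f S} := by
    ext S
    have : ∑ i, (-f (S i) - ∫ z, -f z ∂μ) = n * deviation μ f S := by
      simp only [deviation, integral_neg, Finset.sum_sub_distrib, Finset.sum_neg_distrib,
        Finset.sum_const, Finset.card_univ, Fintype.card_fin, nsmul_eq_mul]
      field_simp
      ring
    simp only [mem_ofPred_eq, this]
    exact mul_le_mul_iff_right₀ hn'
  rw [hset] at key
  -- Values in an interval of length `2 * η` have variance proxy `η ^ 2`, hence `n * η ^ 2` for the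
  -- sum; the threshold is tuned so that the exponent is exactly `-u`.
  have hexp : -(n * (η * √(2 * u / n))) ^ 2 / (2 * ∑ i ∈ (Finset.univ : Finset (Fin n)),
      ((((‖η - -η‖₊ / 2) ^ 2 : ℝ≥0)) : ℝ)) = -u := by
    have h2 : ‖η - -η‖ = 2 * η := by
      rw [Real.norm_eq_abs, abs_of_pos] <;> linarith
    simp only [NNReal.coe_div, coe_nnnorm, h2, Finset.sum_const, Finset.card_univ,
      Fintype.card_fin, nsmul_eq_mul, NNReal.coe_pow, NNReal.coe_ofNat, mul_pow]
    rw [Real.sq_sqrt (by positivity)]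
    field_simp
  rw [NNReal.coe_sum, hexp] at key
  rw [← ofReal_measureReal]
  exact ENNReal.ofReal_le_ofReal key

variable {ι : Type*}

/-- Chaining along nets `N 0, …, N K`: outside an event of probability `ρ ∑ 2⁻ᵏ` the deviations on
the finest net exceed the one at the base point by at most the sum of the link thresholds. -/
lemma exists_chaining_event [IsProbabilityMeasure μ] (hn : 1 ≤ n) {f : ι → Z → ℝ}
    (hf : ∀ b, Measurable (f b)) (hint : ∀ b, Integrable (f b) μ) (b₀ : ι) (N : ℕ → Finset ι)
    (hN0 : N 0 = {b₀}) (hne : ∀ k, (N k).Nonempty) (η : ℕ → ℝ) (hη : ∀ k, 0 < η k)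
    (hnet : ∀ k b, ∃ s ∈ N k, ∀ z, |f b z - f s z| ≤ η k) {ρ : ℝ} (hρ : 0 < ρ) (hρ1 : ρ < 1)
    (K : ℕ) :
    ∃ G : Set (Fin n → Z), MeasurableSet G ∧
      (Measure.pi fun _ : Fin n => μ) Gᶜ ≤
        ENNReal.ofReal (∑ k ∈ Finset.range K, ρ * (1 / 2) ^ (k + 1)) ∧
      ∀ S ∈ G, ∀ s ∈ N K, deviation μ (f s) S - deviation μ (f b₀) S ≤
        ∑ k ∈ Finset.range K, η k *
          √(2 * (Real.log (N (k + 1)).card + (k + 1) * Real.log 2 + Real.log (1 / ρ)) / n) := by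
  induction K with
  | zero =>
    refine ⟨univ, MeasurableSet.univ, by simp, fun S _ s hs => ?_⟩
    rw [hN0, Finset.mem_singleton] at hs
    simp [hs]
  | succ K ih =>
    obtain ⟨G, hG, hGρ, hGdev⟩ := ih
    choose p hpN hp using hnet K
    -- Each `s` in the new net is linked to one parent `p s`. The three terms of `u` pay for the
    -- union over these links, the weight `2⁻¹ ^ (K + 1)` of the level, and `ρ`.
    set u : ℝ := Real.log (N (K + 1)).card + (K + 1) * Real.log 2 + Real.log (1 / ρ) with hu
    have hcard : (1 : ℝ) ≤ (N (K + 1)).card := by exact_mod_cast (hne (K + 1)).card_pos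
    have hu0 : 0 ≤ u := by
      have h1 := Real.log_nonneg hcard
      have h2 := Real.log_nonneg (one_le_one_div hρ hρ1.le)
      have h3 := Real.log_nonneg (one_le_two (α := ℝ))
      positivity
    have hexpu : (N (K + 1)).card * Real.exp (-u) = ρ * (1 / 2) ^ (K + 1) := by
      have h1 : Real.exp (Real.log (N (K + 1)).card) = (N (K + 1)).card :=
        Real.exp_log (by linarith)
      have h2 : Real.exp ((K + 1) * Real.log 2) = 2 ^ (K + 1) := by
        rw [mul_comm, ← Nat.cast_succ, ← Real.rpow_natCast, Real.rpow_def_of_pos two_pos]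
      have h3 : Real.exp (Real.log (1 / ρ)) = 1 / ρ := Real.exp_log (by positivity)
      rw [Real.exp_neg, hu, Real.exp_add, Real.exp_add, h1, h2, h3]
      have : ((N (K + 1)).card : ℝ) ≠ 0 := by linarith
      rw [one_div_pow]
      field_simp
    let B : ι → Set (Fin n → Z) := fun s =>
      {S | η K * √(2 * u / n) ≤ deviation μ (fun z => f s z - f (p s) z) S}
    have hBm : ∀ s, MeasurableSet (B s) := fun s =>
      measurableSet_le measurable_const (measurable_deviation ((hf s).sub (hf (p s))))
    have hBμ : ∀ s, (Measure.pi fun _ : Fin n => μ) (B s) ≤ ENNReal.ofReal (Real.exp (-u)) :=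
      fun s => measure_deviation_ge_le hn ((hf s).sub (hf (p s))) (hη K) (hp s) hu0
    refine ⟨G ∩ ⋂ s ∈ N (K + 1), (B s)ᶜ, hG.inter (Finset.measurableSet_biInter _
      fun s _ => (hBm s).compl), ?_, ?_⟩
    · rw [compl_inter, compl_iInter₂]
      simp only [compl_compl]
      calc _ ≤ (Measure.pi fun _ : Fin n => μ) Gᶜ +
            (Measure.pi fun _ : Fin n => μ) (⋃ s ∈ N (K + 1), B s) := measure_union_le _ _
        _ ≤ ENNReal.ofReal (∑ k ∈ Finset.range K, ρ * (1 / 2) ^ (k + 1)) +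
            ENNReal.ofReal (ρ * (1 / 2) ^ (K + 1)) := by
          refine add_le_add hGρ ((measure_biUnion_finset_le _ _).trans
            ((Finset.sum_le_sum fun s _ => hBμ s).trans ?_))
          rw [Finset.sum_const, ← hexpu, nsmul_eq_mul, ENNReal.ofReal_mul (by positivity),
            ENNReal.ofReal_natCast]
        _ = _ := by
          rw [Finset.sum_range_succ, ENNReal.ofReal_add (Finset.sum_nonneg fun _ _ => by positivity)
            (by positivity)]
    · rintro S ⟨hSG, hSB⟩ s hs
      have h1 := hGdev S hSG (p s) (hpN s)
      have h2 : deviation μ (fun z => f s z - f (p s) z) S < η K * √(2 * u / n) := by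
        have := mem_iInter₂.1 hSB s hs
        simpa [B] using this
      rw [deviation_sub (hint s) (hint (p s))] at h2
      rw [Finset.sum_range_succ]
      simp only [hu] at h2
      linarith

/-- The dyadic sum of square roots of log-cardinalities is bounded by the entropy integral. -/
lemma sum_dyadic_le_lintegral {M : ℝ} (hM : 0 < M) {h : ℝ → ℝ} (a : ℕ → ℝ)
    (ha : ∀ k, ∀ ε, 0 < ε → ε ≤ 2 * M / 2 ^ k → a k ≤ √(h ε))
    (hJ : ∫⁻ ε in Ioc 0 (2 * M), ENNReal.ofReal (√(h ε)) ≠ ⊤) (K : ℕ) :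
    ∑ k ∈ Finset.range K, 2 * M / 2 ^ (k + 1) * a (k + 1) ≤
      2 * (∫⁻ ε in Ioc 0 (2 * M), ENNReal.ofReal (√(h ε))).toReal := by
  -- The interval `I k` has half the length of the weight `2 * M / 2 ^ (k + 1)`, whence the factor
  -- `2`. All its points are at most that scale, so `a (k + 1)` bounds the integrand from below
  -- there.
  let I : ℕ → Set ℝ := fun k => Ioc (2 * M / 2 ^ (k + 2)) (2 * M / 2 ^ (k + 1))
  have hdisj : Pairwise (Function.onFun Disjoint I) := by
    refine (pairwise_disjoint_on I).2 fun i j hij => ?_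
    refine disjoint_left.2 fun x hx hx' => absurd hx.1 (not_lt.2 (hx'.2.trans ?_))
    exact div_le_div_of_nonneg_left (by positivity) (by positivity)
      (pow_le_pow_right₀ one_le_two (by omega))
  have hsub : (⋃ k ∈ Finset.range K, I k) ⊆ Ioc 0 (2 * M) := by
    refine iUnion₂_subset fun k _ x hx => ⟨lt_of_le_of_lt (by positivity) hx.1, hx.2.trans ?_⟩
    exact div_le_self (by positivity) (one_le_pow₀ one_le_two)
  have hlow : ∀ k, ENNReal.ofReal (2 * M / 2 ^ (k + 2) * a (k + 1)) ≤
      ∫⁻ ε in I k, ENNReal.ofReal (√(h ε)) := by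
    intro k
    have hlen : volume (I k) = ENNReal.ofReal (2 * M / 2 ^ (k + 2)) := by
      rw [Real.volume_Ioc]
      congr 1
      field_simp
      ring
    calc _ = ∫⁻ _ in I k, ENNReal.ofReal (a (k + 1)) := by
          rw [setLIntegral_const, hlen, ENNReal.ofReal_mul (by positivity), mul_comm]
      _ ≤ _ := by
          refine setLIntegral_mono' measurableSet_Ioc fun x hx => ENNReal.ofReal_le_ofReal ?_
          exact ha _ _ (lt_of_le_of_lt (by positivity) hx.1) hx.2
  have hsum : ∑ k ∈ Finset.range K, ENNReal.ofReal (2 * M / 2 ^ (k + 2) * a (k + 1)) ≤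
      ∫⁻ ε in Ioc 0 (2 * M), ENNReal.ofReal (√(h ε)) :=
    calc _ ≤ ∑ k ∈ Finset.range K, ∫⁻ ε in I k, ENNReal.ofReal (√(h ε)) :=
          Finset.sum_le_sum fun k _ => hlow k
      _ = ∫⁻ ε in ⋃ k ∈ Finset.range K, I k, ENNReal.ofReal (√(h ε)) :=
          (lintegral_biUnion_finset (hdisj.set_pairwise _) (fun _ _ => measurableSet_Ioc) _).symm
      _ ≤ _ := lintegral_mono_set hsub
  have hreal : ∑ k ∈ Finset.range K, 2 * M / 2 ^ (k + 2) * a (k + 1) ≤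
      (∫⁻ ε in Ioc 0 (2 * M), ENNReal.ofReal (√(h ε))).toReal := by
    refine le_trans (Finset.sum_le_sum fun k _ => ?_) ((ENNReal.toReal_sum fun k _ =>
      ENNReal.ofReal_ne_top).symm.le.trans (ENNReal.toReal_mono hJ hsum))
    rw [ENNReal.toReal_ofReal']
    exact le_max_left _ _
  calc _ = 2 * ∑ k ∈ Finset.range K, 2 * M / 2 ^ (k + 2) * a (k + 1) := by
        rw [Finset.mul_sum]
        refine Finset.sum_congr rfl fun k _ => ?_
        field_simp
        ring
    _ ≤ _ := by linarith

lemma sum_succ_div_two_pow_le (K : ℕ) :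
    ∑ k ∈ Finset.range K, ((k : ℝ) + 1) / 2 ^ k ≤ 4 := by
  have : ∑ k ∈ Finset.range K, ((k : ℝ) + 1) / 2 ^ k = 4 - (2 * K + 4) / 2 ^ K := by
    induction K with
    | zero => norm_num
    | succ K ih =>
      rw [Finset.sum_range_succ, ih]
      push_cast
      field_simp
      ring
  rw [this]
  exact sub_le_self _ (by positivity)

lemma sum_one_div_two_pow_le (K : ℕ) : ∑ k ∈ Finset.range K, (1 : ℝ) / 2 ^ k ≤ 2 := by
  have : ∑ k ∈ Finset.range K, (1 : ℝ) / 2 ^ k = 2 - 2 / 2 ^ K := by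
    induction K with
    | zero => norm_num
    | succ K ih =>
      rw [Finset.sum_range_succ, ih]
      field_simp
      ring
  rw [this]
  exact sub_le_self _ (by positivity)

lemma sum_half_pow_le_one (K : ℕ) {ρ : ℝ} (hρ : 0 < ρ) :
    ∑ k ∈ Finset.range K, ρ * (1 / 2) ^ (k + 1) ≤ ρ := by
  have h : ∑ k ∈ Finset.range K, ρ * (1 / 2) ^ (k + 1) =
      ρ / 2 * ∑ k ∈ Finset.range K, (1 : ℝ) / 2 ^ k := by
    rw [Finset.mul_sum]
    refine Finset.sum_congr rfl fun k _ => ?_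
    rw [one_div_pow]
    field_simp
    ring
  rw [h]
  have := sum_one_div_two_pow_le K
  nlinarith

/-- Separates a link threshold into entropy, level and confidence parts. The condition `1 ≤ B` gives
`D ≤ B ≤ B ^ 2`, which lets the level term leave the root without a root of its own. -/
lemma sqrt_two_mul_add_div_le {A B D L x : ℝ} (hA : 0 ≤ A) (hB : 1 ≤ B) (hL : 0 ≤ L)
    (hx : 0 ≤ x) (hD : D ≤ B) : √(2 * (A + D + L) / x) ≤ 2 * (√A + B + √L) / √x := by
  rw [Real.sqrt_div' _ hx]
  gcongr
  refine Real.sqrt_le_iff.2 ⟨by positivity, ?_⟩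
  have h1 := Real.sq_sqrt hA
  have h2 := Real.sq_sqrt hL
  have h3 := Real.sqrt_nonneg A
  have h4 := Real.sqrt_nonneg L
  nlinarith [mul_nonneg h3 h4, mul_nonneg h3 (zero_le_one.trans hB),
    mul_nonneg h4 (zero_le_one.trans hB)]

/-- A uniform deviation bound of Dudley type: with probability at least `1 - ρ`, the deviations of
all `f b` exceed that of `f b₀` by at most the entropy integral plus a confidence term. -/
lemma exists_uniform_deviation_event [IsProbabilityMeasure μ] (hn : 1 ≤ n) {f : ι → Z → ℝ}
    (hf : ∀ b, Measurable (f b)) (hint : ∀ b, Integrable (f b) μ) (b₀ : ι) {M κ : ℝ} (hM : 0 < M)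
    (hκ : 1 ≤ κ) {h : ℝ → ℝ} (hbase : ∀ b z, |f b z - f b₀ z| ≤ 8 * M ^ 2)
    (hnet : ∀ ε, 0 < ε → ε ≤ 2 * M → ∃ N : Finset ι,
      (∀ b, ∃ s ∈ N, ∀ z, |f b z - f s z| ≤ 4 * M * κ * ε) ∧
      ∀ ε', 0 < ε' → ε' ≤ ε → Real.log N.card ≤ h ε')
    (hJ : ∫⁻ ε in Ioc 0 (2 * M), ENNReal.ofReal (√(h ε)) ≠ ⊤) {ρ : ℝ} (hρ : 0 < ρ) (hρ1 : ρ < 1) :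
    ∃ G : Set (Fin n → Z), MeasurableSet G ∧
      ENNReal.ofReal (1 - ρ) ≤ (Measure.pi fun _ : Fin n => μ) G ∧
      ∀ S ∈ G, ∀ b, deviation μ (f b) S - deviation μ (f b₀) S ≤ 80 * κ * (M ^ 2 / √n +
        M * (∫⁻ ε in Ioc 0 (2 * M), ENNReal.ofReal (√(h ε))).toReal / √n +
        M ^ 2 * √(Real.log (1 / ρ) / n)) := by
  have hn' : (0 : ℝ) < n := by exact_mod_cast hn
  have hκ0 : 0 < κ := by linarith
  have hL : 0 ≤ Real.log (1 / ρ) := Real.log_nonneg (one_le_one_div hρ hρ1.le)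
  have hscale : ∀ k : ℕ, 0 < 2 * M / 2 ^ (k + 1) ∧ 2 * M / 2 ^ (k + 1) ≤ 2 * M := fun k =>
    ⟨by positivity, div_le_self (by positivity) (one_le_pow₀ one_le_two)⟩
  choose N' hN' hN'h using fun k : ℕ => hnet _ (hscale k).1 (hscale k).2
  -- Level `k` has scale `2 * M / 2 ^ k`. At level `0` the single point `b₀` is a net because `8 * M
  -- ^ 2 ≤ 4 * M * κ * (2 * M)`, which is where `1 ≤ κ` is needed.
  let N : ℕ → Finset ι := fun k => Nat.casesOn k {b₀} N'
  let η : ℕ → ℝ := fun k => 4 * M * κ * (2 * M / 2 ^ k)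
  have hcov : ∀ k b, ∃ s ∈ N k, ∀ z, |f b z - f s z| ≤ η k := by
    rintro (_ | k) b
    · refine ⟨b₀, Finset.mem_singleton_self _, fun z => (hbase b z).trans ?_⟩
      have : 8 * M ^ 2 * 1 ≤ 8 * M ^ 2 * κ := by gcongr
      simp only [η, pow_zero]
      linarith
    · exact hN' k b
  -- Stopping after `n` levels suffices: `√n ≤ 2 ^ n` makes the remainder of order `M ^ 2 / √n`.
  obtain ⟨G, hG, hGρ, hGdev⟩ := exists_chaining_event hn hf hint b₀ N rfl
    (fun k => let ⟨s, hs, _⟩ := hcov k b₀; ⟨s, hs⟩) η (fun k => by positivity) hcov hρ hρ1 n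
  refine ⟨G, hG, ?_, fun S hS b => ?_⟩
  · have h1 : (Measure.pi fun _ : Fin n => μ) Gᶜ ≤ ENNReal.ofReal ρ :=
      hGρ.trans (ENNReal.ofReal_le_ofReal (sum_half_pow_le_one n hρ))
    rw [← compl_compl G, prob_compl_eq_one_sub hG.compl, ENNReal.ofReal_sub _ hρ.le,
      ENNReal.ofReal_one]
    exact tsub_le_tsub_left h1 _
  obtain ⟨s, hs, hbs⟩ := hcov n b
  have h1 := hGdev S hS s hs
  have h2 : deviation μ (f b) S - deviation μ (f s) S ≤ 16 * κ * (M ^ 2 / √n) := by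
    rw [← deviation_sub (hint b) (hint s)]
    refine (deviation_le hn hbs S).trans ?_
    have h3 : √(n : ℝ) ≤ 2 ^ n := by
      rw [Real.sqrt_le_left (by positivity)]
      have : (n : ℝ) ≤ 2 ^ n := by exact_mod_cast n.lt_two_pow_self.le
      exact this.trans (le_self_pow₀ (one_le_pow₀ one_le_two) two_ne_zero)
    calc 2 * η n = 16 * κ * (M ^ 2 / 2 ^ n) := by simp only [η]; ring
      _ ≤ _ := by gcongr
  set J := (∫⁻ ε in Ioc 0 (2 * M), ENNReal.ofReal (√(h ε))).toReal
  -- The value at `0` is a filler: only the indices `k + 1` are summed.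
  let a : ℕ → ℝ := fun k => Nat.casesOn k 0 fun k => √(Real.log (N' k).card)
  have hsumJ := sum_dyadic_le_lintegral hM (h := h) a (by
    rintro (_ | k) ε hε hεk
    · exact Real.sqrt_nonneg _
    · exact Real.sqrt_le_sqrt (hN'h k ε hε hεk)) hJ n
  have h4 : ∀ k ∈ Finset.range n, η k * √(2 * (Real.log (N (k + 1)).card + (k + 1) * Real.log 2 +
      Real.log (1 / ρ)) / n) ≤ 16 * κ * M / √n * (2 * M / 2 ^ (k + 1) * a (k + 1) +
        M * ((k + 1) / 2 ^ k) + M * √(Real.log (1 / ρ)) * (1 / 2 ^ k)) := by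
    intro k _
    have h5 : ((k : ℝ) + 1) * Real.log 2 ≤ k + 1 := by
      have := Real.log_two_lt_d9
      have : ((k : ℝ) + 1) * Real.log 2 ≤ (k + 1) * 1 := by gcongr; linarith
      linarith
    calc _ ≤ η k * (2 * (√(Real.log (N (k + 1)).card) + (k + 1) + √(Real.log (1 / ρ))) / √n) := by
          gcongr
          exact sqrt_two_mul_add_div_le (Real.log_natCast_nonneg _) (by simp) hL hn'.le h5
      _ = _ := by
          simp only [η, a, N]
          field_simp
          ring
  have h6 := (Finset.sum_le_sum h4)
  rw [← Finset.mul_sum, Finset.sum_add_distrib, Finset.sum_add_distrib, ← Finset.mul_sum,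
    ← Finset.mul_sum] at h6
  have h7 : 16 * κ * M / √n * (∑ k ∈ Finset.range n, 2 * M / 2 ^ (k + 1) * a (k + 1) +
      M * ∑ k ∈ Finset.range n, ((k : ℝ) + 1) / 2 ^ k +
      M * √(Real.log (1 / ρ)) * ∑ k ∈ Finset.range n, (1 : ℝ) / 2 ^ k) ≤
      16 * κ * M / √n * (2 * J + M * 4 + M * √(Real.log (1 / ρ)) * 2) := by
    gcongr
    · exact sum_succ_div_two_pow_le n
    · exact sum_one_div_two_pow_le n
  have h8 : √(Real.log (1 / ρ) / n) = √(Real.log (1 / ρ)) / √n := Real.sqrt_div hL _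
  -- The `64` here and the `16` from the finest-scale remainder `h2` add up to the final `80`.
  have h9 : 16 * κ * M / √n * (2 * J + M * 4 + M * √(Real.log (1 / ρ)) * 2) =
      64 * κ * (M ^ 2 / √n) + 32 * κ * (M * J / √n) +
        32 * κ * (M ^ 2 * (√(Real.log (1 / ρ)) / √n)) := by ring
  have hJ0 : 0 ≤ κ * (M * J / √n) := by positivity
  have hr0 : 0 ≤ κ * (M ^ 2 * (√(Real.log (1 / ρ)) / √n)) := by positivity
  rw [h8]
  linarith

end Deviation

/-! ### The Picard map -/

section PicardMap

variable {d : ℕ} {D : Set (Space d)} {T : ℝ} {ω : EquationSpec D} {u₀ : InitialFun D}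
  {v w w' : SpaceTimeFun D T}

/-- The classes of `u₀` and of `F(v(τ))` in `L²(D)` are determined, so both images agree almost
everywhere at each time. Volume charges every nonempty open subset of the open set `D`, so
continuity upgrades this to equality. The choice in `picardMap` is therefore harmless. -/
lemma IsPicardImage.unique (hD : IsOpen D) (hw : IsPicardImage ω u₀ v w)
    (hw' : IsPicardImage ω u₀ v w') : w = w' := by
  obtain ⟨f, g, hf, hg, h⟩ := hw
  obtain ⟨f', g', hf', hg', h'⟩ := hw'
  have : (volOn D).IsOpenPosMeasure :=
    Measure.IsOpenPosMeasure.comap volume hD.isOpenEmbedding_subtypeVal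
  have hff : f = f' := Lp.ext (by filter_upwards [hf, hf'] with x h₁ h₂ using h₁.trans h₂.symm)
  have hgg : ∀ τ ∈ Icc 0 T, g τ = g' τ := fun τ hτ =>
    Lp.ext (by filter_upwards [hg ⟨τ, hτ⟩, hg' ⟨τ, hτ⟩] with x h₁ h₂ using h₁.trans h₂.symm)
  ext ⟨x, t⟩
  have hint : ∫ τ in (0 : ℝ)..t, ω.semigroup.op (t - τ).toNNReal (g τ) =
      ∫ τ in (0 : ℝ)..t, ω.semigroup.op (t - τ).toNNReal (g' τ) := by
    refine intervalIntegral.integral_congr fun τ hτ => ?_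
    rw [uIcc_of_le t.2.1] at hτ
    simp only [hgg τ ⟨hτ.1, hτ.2.trans t.2.2⟩]
  have hae : (fun x => w (x, t)) =ᵐ[volOn D] fun x => w' (x, t) := by
    filter_upwards [(h t).2, (h' t).2] with x hx hx'
    rw [← hx, ← hx', hff, hint]
  exact congrFun ((Continuous.ae_eq_iff_eq _ (by fun_prop) (by fun_prop)).1 hae) x

lemma IsPicardImage.picardMap_eq (hD : IsOpen D) (hw : IsPicardImage ω u₀ v w) :
    picardMap ω u₀ v = w := by
  have h : ∃ w, IsPicardImage ω u₀ v w := ⟨w, hw⟩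
  rw [picardMap, dif_pos h]
  exact h.choose_spec.unique hD hw

lemma norm_solutionOperator_le {M : ℝ} (hM : 0 ≤ M) : ‖solutionOperator T M ω u₀‖ ≤ M := by
  unfold solutionOperator
  split_ifs with h
  · exact h.choose_spec.1
  · simpa using hM

namespace UniformContraction

variable {R M C_S δ : ℝ} {Ω : Set (EquationSpec D)}

lemma isPicardImage (h : UniformContraction T R M C_S δ Ω) (hD : IsOpen D) (hω : ω ∈ Ω)
    (hu : ‖u₀‖ ≤ R) (hv : ‖v‖ ≤ M) : IsPicardImage ω u₀ v (picardMap ω u₀ v) := by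
  obtain ⟨w, _, hw⟩ := h.maps ω hω u₀ hu v hv
  rwa [hw.picardMap_eq hD]

lemma norm_picardMap_le (h : UniformContraction T R M C_S δ Ω) (hD : IsOpen D) (hω : ω ∈ Ω)
    (hu : ‖u₀‖ ≤ R) (hv : ‖v‖ ≤ M) : ‖picardMap ω u₀ v‖ ≤ M := by
  obtain ⟨w, hwM, hw⟩ := h.maps ω hω u₀ hu v hv
  rwa [hw.picardMap_eq hD]

/-- Banach's theorem on the closed `M`-ball, which is complete. -/
lemma exists_fixedPoint (h : UniformContraction T R M C_S δ Ω) (hD : IsOpen D) (hδ : 0 ≤ δ)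
    (hδ1 : δ < 1) (hM : 0 ≤ M) (hω : ω ∈ Ω) (hu : ‖u₀‖ ≤ R) :
    ∃ u : SpaceTimeFun D T, ‖u‖ ≤ M ∧ picardMap ω u₀ u = u := by
  have hmaps : MapsTo (picardMap ω u₀) (Metric.closedBall (0 : SpaceTimeFun D T) M)
      (Metric.closedBall 0 M) := fun v hv => by
    rw [mem_closedBall_zero_iff] at hv ⊢
    exact h.norm_picardMap_le hD hω hu hv
  have hcontr : ContractingWith ⟨δ, hδ⟩ hmaps.restrict := by
    refine ⟨by exact_mod_cast hδ1, LipschitzWith.of_dist_le_mul fun x y => ?_⟩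
    have := h.contraction ω hω u₀ hu x.1 y.1 (mem_closedBall_zero_iff.1 x.2)
      (mem_closedBall_zero_iff.1 y.2)
    rw [Subtype.dist_eq, Subtype.dist_eq, dist_eq_norm, dist_eq_norm]
    exact this
  obtain ⟨u, hu, hfix, _⟩ := hcontr.exists_fixedPoint' Metric.isClosed_closedBall.isComplete hmaps
    (x := 0) (Metric.mem_closedBall_self hM) (edist_ne_top _ _)
  exact ⟨u, mem_closedBall_zero_iff.1 hu, hfix⟩

/-- The Banach fixed point is a Picard image of itself, so the default value `0` in
`solutionOperator` is never taken. -/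
lemma picardMap_solutionOperator (h : UniformContraction T R M C_S δ Ω) (hD : IsOpen D)
    (hδ : 0 ≤ δ) (hδ1 : δ < 1) (hM : 0 ≤ M) (hω : ω ∈ Ω) (hu : ‖u₀‖ ≤ R) :
    picardMap ω u₀ (solutionOperator T M ω u₀) = solutionOperator T M ω u₀ := by
  obtain ⟨u, huM, hfix⟩ := h.exists_fixedPoint hD hδ hδ1 hM hω hu
  have hex : ∃ u : SpaceTimeFun D T, ‖u‖ ≤ M ∧ IsPicardImage ω u₀ u u :=
    ⟨u, huM, by simpa only [hfix] using h.isPicardImage hD hω hu huM⟩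
  rw [solutionOperator, dif_pos hex]
  exact hex.choose_spec.2.picardMap_eq hD

lemma norm_iterate_le (h : UniformContraction T R M C_S δ Ω) (hD : IsOpen D) (hM : 0 ≤ M)
    (hω : ω ∈ Ω) (hu : ‖u₀‖ ≤ R) (ℓ : ℕ) :
    ‖(picardMap ω u₀)^[ℓ] (0 : SpaceTimeFun D T)‖ ≤ M := by
  induction ℓ with
  | zero => simpa using hM
  | succ ℓ ih =>
    rw [Function.iterate_succ_apply']
    exact h.norm_picardMap_le hD hω hu ih

/-- The iteration starts at `0`, at distance at most `M` from the solution, and each step gains a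
factor `δ`. -/
lemma norm_iterate_sub_solutionOperator_le (h : UniformContraction T R M C_S δ Ω) (hD : IsOpen D)
    (hδ : 0 ≤ δ) (hδ1 : δ < 1) (hM : 0 ≤ M) (hω : ω ∈ Ω) (hu : ‖u₀‖ ≤ R) (ℓ : ℕ) :
    ‖(picardMap ω u₀)^[ℓ] 0 - solutionOperator T M ω u₀‖ ≤ δ ^ ℓ * M := by
  induction ℓ with
  | zero => simpa using norm_solutionOperator_le hM
  | succ ℓ ih =>
    rw [Function.iterate_succ_apply', ← h.picardMap_solutionOperator hD hδ hδ1 hM hω hu]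
    refine (h.contraction ω hω u₀ hu _ _ (h.norm_iterate_le hD hM hω hu ℓ)
      (norm_solutionOperator_le hM)).trans ?_
    rw [pow_succ', mul_assoc]
    gcongr

/-- Stability of the Picard iterates under a perturbation of the Picard map. -/
lemma norm_iterate_sub_iterate_le (h : UniformContraction T R M C_S δ Ω) (hD : IsOpen D)
    (hδ : 0 ≤ δ) (hδ1 : δ < 1) (hM : 0 ≤ M) {ω' : EquationSpec D} {v₀ : InitialFun D}
    (hω : ω ∈ Ω) (hω' : ω' ∈ Ω) (hu : ‖u₀‖ ≤ R) (hv : ‖v₀‖ ≤ R) {ε : ℝ} (hε : 0 ≤ ε)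
    (hclose : ∀ u : SpaceTimeFun D T, ‖u‖ ≤ M → ‖picardMap ω u₀ u - picardMap ω' v₀ u‖ ≤ ε)
    (ℓ : ℕ) :
    ‖(picardMap ω u₀)^[ℓ] (0 : SpaceTimeFun D T) - (picardMap ω' v₀)^[ℓ] 0‖ ≤ ε / (1 - δ) := by
  have hδ' : 0 < 1 - δ := by linarith
  induction ℓ with
  | zero => simpa using by positivity
  | succ ℓ ih =>
    rw [Function.iterate_succ_apply', Function.iterate_succ_apply']
    have hb := h.norm_iterate_le hD hM hω hu ℓ
    have hb' := h.norm_iterate_le hD hM hω' hv ℓ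
    -- The intermediate point applies the first Picard map to the second iterate. Contraction and
    -- closeness then give `x ↦ δ * x + ε`, whose fixed point is `ε / (1 - δ)`.
    refine (norm_sub_le_norm_sub_add_norm_sub _
      (picardMap ω u₀ ((picardMap ω' v₀)^[ℓ] 0)) _).trans ?_
    calc _ ≤ δ * (ε / (1 - δ)) + ε :=
          add_le_add ((h.contraction ω hω u₀ hu _ _ hb hb').trans (by gcongr)) (hclose _ hb')
      _ = ε / (1 - δ) := by
          field_simp
          ring

/-- Inserting a mixed term bounds the difference by `δ` times itself plus the `C_S` term, and the
former is absorbed on the left. It serves to make the target measurable. -/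
lemma norm_solutionOperator_sub_le (h : UniformContraction T R M C_S δ Ω) (hD : IsOpen D)
    (hδ : 0 ≤ δ) (hδ1 : δ < 1) (hM : 0 ≤ M) {v₀ : InitialFun D} (hω : ω ∈ Ω) (hu : ‖u₀‖ ≤ R)
    (hv : ‖v₀‖ ≤ R) :
    ‖solutionOperator T M ω u₀ - solutionOperator T M ω v₀‖ ≤ C_S / (1 - δ) * ‖u₀ - v₀‖ := by
  have hδ' : 0 < 1 - δ := by linarith
  have hb : ‖solutionOperator T M ω u₀‖ ≤ M := norm_solutionOperator_le hM
  have hb' : ‖solutionOperator T M ω v₀‖ ≤ M := norm_solutionOperator_le hM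
  have h1 := norm_sub_le_norm_sub_add_norm_sub (picardMap ω u₀ (solutionOperator T M ω u₀))
    (picardMap ω u₀ (solutionOperator T M ω v₀)) (picardMap ω v₀ (solutionOperator T M ω v₀))
  have h2 := h.contraction ω hω u₀ hu _ _ hb hb'
  have h3 := h.lipschitz ω hω u₀ v₀ hu hv _ hb'
  rw [h.picardMap_solutionOperator hD hδ hδ1 hM hω hu,
    h.picardMap_solutionOperator hD hδ hδ1 hM hω hv] at h1
  rw [h.picardMap_solutionOperator hD hδ hδ1 hM hω hu] at h2
  rw [h.picardMap_solutionOperator hD hδ hδ1 hM hω hv] at h3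
  rw [div_mul_eq_mul_div, le_div_iff₀ hδ']
  linarith

end UniformContraction

end PicardMap

lemma SpaceTimeFun.abs_eval_le {d : ℕ} {D : Set (Space d)} {T : ℝ} (u : SpaceTimeFun D T)
    (z : Cylinder D T) : |u.eval z| ≤ ‖u‖ :=
  u.norm_coe_le_norm _

lemma SpaceTimeFun.eval_sub {d : ℕ} {D : Set (Space d)} {T : ℝ} (u v : SpaceTimeFun D T)
    (z : Cylinder D T) : SpaceTimeFun.eval (u - v) z = u.eval z - v.eval z := rfl

lemma SpaceTimeFun.continuous_eval {d : ℕ} {D : Set (Space d)} {T : ℝ} :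
    Continuous fun p : SpaceTimeFun D T × Cylinder D T => p.1.eval p.2 := by
  unfold SpaceTimeFun.eval
  fun_prop

/-! ### Models and target -/

namespace Setting

variable {M C_S δ : ℝ} (P : Setting M C_S δ) {ω ω' : EquationSpec P.D}

lemma norm_U0R_le (v : P.U0R) : ‖v.1‖ ≤ P.R := mem_closedBall_zero_iff.1 v.2

lemma model_eq (ω : EquationSpec P.D) (ℓ : ℕ) (v : P.U0R) (z : P.Q) :
    P.model ω ℓ v z = ((picardMap ω v.1)^[ℓ] (0 : SpaceTimeFun P.D P.T)).eval z := by
  have : ∀ ℓ, (P.step ω)^[ℓ] (v, z, 0) = (v, z, (picardMap ω v.1)^[ℓ] 0) := by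
    intro ℓ
    induction ℓ with
    | zero => rfl
    | succ ℓ ih => simp only [Function.iterate_succ_apply', ih, step]
  simp only [model, this]

variable (hδ : 0 < δ) (hδ1 : δ < 1) (hM : 0 < M)

include hM in
lemma abs_model_le (hω : ω ∈ P.Ω) (ℓ : ℕ) (v : P.U0R) (z : P.Q) : |P.model ω ℓ v z| ≤ M := by
  rw [model_eq]
  exact (SpaceTimeFun.abs_eval_le _ _).trans
    (P.contraction.norm_iterate_le P.isOpen_D hM.le hω (P.norm_U0R_le v) ℓ)

include hM in
lemma abs_target_le (u : P.U0) (z : P.Q) : |P.target u z| ≤ M :=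
  (SpaceTimeFun.abs_eval_le _ _).trans (norm_solutionOperator_le hM.le)

include hδ hδ1 hM

lemma abs_model_sub_target_le (ℓ : ℕ) (u : P.U0) (z : P.Q) :
    |P.model P.ωstar ℓ (P.incl u) z - P.target u z| ≤ δ ^ ℓ * M := by
  rw [model_eq, target, ← SpaceTimeFun.eval_sub]
  exact (SpaceTimeFun.abs_eval_le _ _).trans
    (P.contraction.norm_iterate_sub_solutionOperator_le P.isOpen_D hδ.le hδ1 hM.le P.ωstar_mem
      (P.norm_U0R_le (P.incl u)) ℓ)

lemma norm_iterate_sub_iterate_le (hC : 0 ≤ C_S) (hω : ω ∈ P.Ω) (ℓ : ℕ) (v v' : P.U0R) :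
    ‖(picardMap ω v.1)^[ℓ] (0 : SpaceTimeFun P.D P.T) - (picardMap ω v'.1)^[ℓ] 0‖ ≤
      C_S * ‖v.1 - v'.1‖ / (1 - δ) :=
  P.contraction.norm_iterate_sub_iterate_le P.isOpen_D hδ.le hδ1 hM.le hω hω (P.norm_U0R_le v)
    (P.norm_U0R_le v') (by positivity)
    (P.contraction.lipschitz ω hω _ _ (P.norm_U0R_le v) (P.norm_U0R_le v')) ℓ

lemma abs_model_sub_model_le (hC : 0 ≤ C_S) (hω : ω ∈ P.Ω) (ℓ : ℕ) (v v' : P.U0R) (z : P.Q) :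
    |P.model ω ℓ v z - P.model ω ℓ v' z| ≤ C_S * ‖v.1 - v'.1‖ / (1 - δ) := by
  rw [model_eq, model_eq, ← SpaceTimeFun.eval_sub]
  exact (SpaceTimeFun.abs_eval_le _ _).trans
    (P.norm_iterate_sub_iterate_le hδ hδ1 hM hC hω ℓ v v')

lemma abs_model_sub_model_le_of_edist_le (hω : ω ∈ P.Ω) (hω' : ω' ∈ P.Ω) {ε : ℝ} (hε : 0 ≤ ε)
    (h : (specPseudoEMetric P.D P.T P.R M).edist ω ω' ≤ ENNReal.ofReal ε) (ℓ : ℕ) (v : P.U0R)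
    (z : P.Q) : |P.model ω ℓ v z - P.model ω' ℓ v z| ≤ ε / (1 - δ) := by
  rw [model_eq, model_eq, ← SpaceTimeFun.eval_sub]
  refine (SpaceTimeFun.abs_eval_le _ _).trans
    (P.contraction.norm_iterate_sub_iterate_le P.isOpen_D hδ.le hδ1 hM.le hω hω' (P.norm_U0R_le v)
      (P.norm_U0R_le v) hε (fun u hu => ?_) ℓ)
  have h1 := (le_iSup₂ (f := fun (u₀ : Metric.closedBall (0 : InitialFun P.D) P.R)
    (u : Metric.closedBall (0 : SpaceTimeFun P.D P.T) M) =>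
      edist (picardMap ω u₀.1 u.1) (picardMap ω' u₀.1 u.1)) v
        ⟨u, mem_closedBall_zero_iff.2 hu⟩).trans h
  rw [← dist_eq_norm]
  exact (edist_le_ofReal hε).1 h1

/-- The iterates are Lipschitz in the initial datum, and evaluation is jointly continuous in
function and query point. -/
lemma measurable_model (hC : 0 ≤ C_S) (hω : ω ∈ P.Ω) (ℓ : ℕ) :
    Measurable fun p : P.U0 × P.Q => P.model ω ℓ (P.incl p.1) p.2 := by
  simp only [model_eq]
  have hδ' : 0 < 1 - δ := by linarith
  have hc : Continuous fun u : P.U0 => (picardMap ω u.1)^[ℓ] (0 : SpaceTimeFun P.D P.T) := by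
    refine (LipschitzWith.of_dist_le_mul (K := ⟨C_S / (1 - δ), by positivity⟩)
      fun u u' => ?_).continuous
    rw [dist_eq_norm, Subtype.dist_eq, dist_eq_norm]
    exact (P.norm_iterate_sub_iterate_le hδ hδ1 hM hC hω ℓ (P.incl u) (P.incl u')).trans_eq
      (mul_div_right_comm _ _ _)
  exact (SpaceTimeFun.continuous_eval.comp
    ((hc.comp continuous_fst).prodMk continuous_snd)).measurable

lemma measurable_target (hC : 0 ≤ C_S) :
    Measurable fun p : P.U0 × P.Q => P.target p.1 p.2 := by
  have hδ' : 0 < 1 - δ := by linarith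
  have hc : Continuous fun u : P.U0 => solutionOperator P.T M P.ωstar u.1 := by
    refine (LipschitzWith.of_dist_le_mul (K := ⟨C_S / (1 - δ), by positivity⟩)
      fun u u' => ?_).continuous
    rw [dist_eq_norm, Subtype.dist_eq, dist_eq_norm]
    exact P.contraction.norm_solutionOperator_sub_le P.isOpen_D hδ.le hδ1 hM.le P.ωstar_mem
      (P.norm_U0R_le (P.incl u)) (P.norm_U0R_le (P.incl u'))
  exact (SpaceTimeFun.continuous_eval.comp
    ((hc.comp continuous_fst).prodMk continuous_snd)).measurable

end Setting

/-! ### Covers -/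

/-- `H` need not be monotone, but covering numbers are: a minimal cover at scale `ε` is no larger
than one at any `ε' ≤ ε`. This gives the bound at all smaller scales that the comparison with the
entropy integral requires. -/
lemma exists_finset_cover_of_entropy_le {X : Type*} [PseudoEMetricSpace X] {A : Set X} {H : ℝ → ℝ}
    (hH : ∀ ε : ℝ≥0, 0 < ε → Metric.coveringNumber ε A ≠ ⊤ ∧
      Real.log ((Metric.coveringNumber ε A).toNat : ℝ) ≤ H ε) {ε : ℝ} (hε : 0 < ε) :
    ∃ N : Finset A, (∀ x : A, ∃ s ∈ N, edist x.1 s.1 ≤ ENNReal.ofReal ε) ∧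
      ∀ ε', 0 < ε' → ε' ≤ ε → Real.log N.card ≤ H ε' := by
  obtain ⟨C, hCA, hfin, hcov, hcard⟩ := Metric.exists_set_encard_eq_coveringNumber
    (hH ε.toNNReal (Real.toNNReal_pos.2 hε)).1
  have hfin' : (Subtype.val ⁻¹' C : Set A).Finite := hfin.preimage Subtype.val_injective.injOn
  have hN : hfin'.toFinset.card = (Metric.coveringNumber ε.toNNReal A).toNat := by
    rw [← hcard, ← Set.ncard_eq_toFinset_card _ hfin', ← Set.ncard_def,
      ← Set.ncard_image_of_injective _ Subtype.val_injective, Subtype.image_preimage_coe,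
      inter_eq_right.2 hCA]
  refine ⟨hfin'.toFinset, fun x => ?_, fun ε' hε' hle => ?_⟩
  · obtain ⟨y, hy, hxy⟩ := hcov x.2
    exact ⟨⟨y, hCA hy⟩, by simpa using hy, hxy⟩
  · have h' := hH ε'.toNNReal (Real.toNNReal_pos.2 hε')
    rw [Real.coe_toNNReal _ hε'.le] at h'
    refine le_trans ?_ h'.2
    rw [hN]
    have hle' : (Metric.coveringNumber ε.toNNReal A).toNat ≤
        (Metric.coveringNumber ε'.toNNReal A).toNat :=
      ENat.toNat_le_toNat (Metric.coveringNumber_anti (Real.toNNReal_le_toNNReal hle)) h'.1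
    -- An empty cover has `Real.log 0 = 0`, so monotonicity of the logarithm is replaced by
    -- nonnegativity.
    rcases Nat.eq_zero_or_pos (Metric.coveringNumber ε.toNNReal A).toNat with h0 | h0
    · rw [h0]
      simpa using Real.log_natCast_nonneg _
    · exact Real.log_le_log (by exact_mod_cast h0) (by exact_mod_cast hle')

/-! ### Empirical risk minimization -/

lemma clip_eq_self {M y : ℝ} (h : |y| ≤ M) : clip M y = y := by
  have := abs_le.1 h
  rw [clip, min_eq_right this.2, max_eq_right this.1]

/-- A difference of squares factors as `(a + a' - 2 * t) * (a - a')`, and the first factor is at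
most `4 * M`. -/
lemma abs_sub_sq_sub_sub_sq_le {M a a' t ε : ℝ} (ha : |a| ≤ M) (ha' : |a'| ≤ M) (ht : |t| ≤ M)
    (h : |a - a'| ≤ ε) : |(a - t) ^ 2 - (a' - t) ^ 2| ≤ 4 * M * ε := by
  have h1 : (a - t) ^ 2 - (a' - t) ^ 2 = (a + a' - 2 * t) * (a - a') := by ring
  rw [h1, abs_mul]
  have h2 : |a + a' - 2 * t| ≤ 4 * M := by
    rw [abs_le] at *
    constructor <;> linarith [ha.1, ha.2, ha'.1, ha'.2, ht.1, ht.2]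
  exact mul_le_mul h2 h (abs_nonneg _) ((abs_nonneg _).trans h2)

namespace Setting

variable {M C_S δ : ℝ} (P : Setting M C_S δ)

instance : IsProbabilityMeasure P.Pi := P.isProb_Pi

instance : IsProbabilityMeasure P.mu := P.isProb_mu

/-- The empirical loss of a single trajectory block. -/
noncomputable def blockLoss {q : ℕ} (Γ : P.U0 → P.Q → ℝ) (x : P.U0 × (Fin q → P.Q)) : ℝ :=
  1 / (q : ℝ) * ∑ j, clippedLoss M (Γ x.1 (x.2 j)) (P.target x.1 (x.2 j))

lemma clippedLoss_target (hM : 0 < M) {y : ℝ} (hy : |y| ≤ M) (u : P.U0) (z : P.Q) :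
    clippedLoss M y (P.target u z) = (y - P.target u z) ^ 2 := by
  rw [clippedLoss, clip_eq_self hy, clip_eq_self (P.abs_target_le hM u z)]

lemma sq_sub_target_le (hM : 0 < M) {y : ℝ} (hy : |y| ≤ M) (u : P.U0) (z : P.Q) :
    |y - P.target u z| ^ 2 ≤ 4 * M ^ 2 := by
  have h := P.abs_target_le hM u z
  have : |y - P.target u z| ≤ 2 * M := (abs_sub _ _).trans (by linarith)
  calc _ ≤ (2 * M) ^ 2 := by gcongr
    _ = _ := by ring

lemma risk_nonneg (Γ : P.U0 → P.Q → ℝ) : 0 ≤ P.risk Γ :=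
  integral_nonneg fun _ => by positivity

lemma risk_le_of_sq_le {Γ : P.U0 → P.Q → ℝ} {B : ℝ}
    (h : ∀ u z, |Γ u z - P.target u z| ^ 2 ≤ B) : P.risk Γ ≤ B := by
  have := integral_mono_of_nonneg (μ := P.Pi.prod P.mu)
    (f := fun p => |Γ p.1 p.2 - P.target p.1 p.2| ^ 2) (g := fun _ => B)
    (ae_of_all _ fun _ => by positivity) (integrable_const _) (ae_of_all _ fun p => h p.1 p.2)
  simpa [risk] using this

variable (hM : 0 < M) {q : ℕ} {Γ Γ' : P.U0 → P.Q → ℝ}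

include hM

lemma risk_le (hΓ : ∀ u z, |Γ u z| ≤ M) : P.risk Γ ≤ 4 * M ^ 2 :=
  P.risk_le_of_sq_le fun u z => P.sq_sub_target_le hM (hΓ u z) u z

lemma abs_blockLoss_sub_le (hq : 1 ≤ q) (hΓ : ∀ u z, |Γ u z| ≤ M) (hΓ' : ∀ u z, |Γ' u z| ≤ M)
    {ε : ℝ} (h : ∀ u z, |Γ u z - Γ' u z| ≤ ε) (x : P.U0 × (Fin q → P.Q)) :
    |P.blockLoss Γ x - P.blockLoss Γ' x| ≤ 4 * M * ε := by
  have hq' : (0 : ℝ) < q := by exact_mod_cast hq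
  rw [blockLoss, blockLoss, ← mul_sub, ← Finset.sum_sub_distrib, abs_mul, abs_of_nonneg
    (by positivity : (0 : ℝ) ≤ 1 / q), one_div, inv_mul_le_iff₀ hq']
  refine (Finset.abs_sum_le_sum_abs _ _).trans ((Finset.sum_le_card_nsmul _ _ (4 * M * ε)
    fun j _ => ?_).trans_eq (by simp))
  rw [P.clippedLoss_target hM (hΓ _ _), P.clippedLoss_target hM (hΓ' _ _)]
  exact abs_sub_sq_sub_sub_sq_le (hΓ _ _) (hΓ' _ _) (P.abs_target_le hM _ _) (h _ _)

variable (hδ : 0 < δ) (hδ1 : δ < 1) (hC : 0 ≤ C_S)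

include hδ hδ1 hC

lemma measurable_blockLoss (hΓ : Measurable fun p : P.U0 × P.Q => Γ p.1 p.2) :
    Measurable (P.blockLoss Γ : P.U0 × (Fin q → P.Q) → ℝ) := by
  have ht := P.measurable_target hδ hδ1 hM hC
  have hpair : ∀ j, Measurable fun x : P.U0 × (Fin q → P.Q) => (x.1, x.2 j) := fun j => by fun_prop
  have h1 := fun j => hΓ.comp (hpair j)
  have h2 := fun j => ht.comp (hpair j)
  simp only [Function.comp_def] at h1 h2
  unfold blockLoss clippedLoss clip
  fun_prop

/-- Clipping is inactive, and each pair of the datum with its `j`-th query point has law `Π ⊗ μ`. By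
linearity, dependence among the pairs of one block is irrelevant. -/
lemma integral_blockLoss (hq : 1 ≤ q) (hΓ : Measurable fun p : P.U0 × P.Q => Γ p.1 p.2)
    (hΓM : ∀ u z, |Γ u z| ≤ M) :
    ∫ x, P.blockLoss Γ x ∂(P.Pi.prod (Measure.pi fun _ : Fin q => P.mu)) = P.risk Γ := by
  have hq' : (q : ℝ) ≠ 0 := by positivity
  have ht := P.measurable_target hδ hδ1 hM hC
  have hmeas : Measurable fun p : P.U0 × P.Q => |Γ p.1 p.2 - P.target p.1 p.2| ^ 2 := by fun_prop
  have hint : Integrable (fun p : P.U0 × P.Q => |Γ p.1 p.2 - P.target p.1 p.2| ^ 2)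
      (P.Pi.prod P.mu) := by
    refine Integrable.of_bound hmeas.aestronglyMeasurable (4 * M ^ 2) (ae_of_all _ fun p => ?_)
    rw [Real.norm_of_nonneg (by positivity)]
    exact P.sq_sub_target_le hM (hΓM _ _) _ _
  have hmp : ∀ j : Fin q, MeasurePreserving (Prod.map id (Function.eval j))
      (P.Pi.prod (Measure.pi fun _ : Fin q => P.mu)) (P.Pi.prod P.mu) := fun j =>
    (MeasurePreserving.id P.Pi).prod (measurePreserving_eval (fun _ : Fin q => P.mu) j)
  have hj : ∀ j : Fin q, ∫ x, |Γ x.1 (x.2 j) - P.target x.1 (x.2 j)| ^ 2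
      ∂(P.Pi.prod (Measure.pi fun _ : Fin q => P.mu)) = P.risk Γ := fun j => by
    rw [risk, ← (hmp j).map_eq, integral_map (hmp j).aemeasurable hmeas.aestronglyMeasurable]
    rfl
  have hblock : ∀ x : P.U0 × (Fin q → P.Q), P.blockLoss Γ x =
      1 / (q : ℝ) * ∑ j, |Γ x.1 (x.2 j) - P.target x.1 (x.2 j)| ^ 2 := fun x => by
    simp only [blockLoss, P.clippedLoss_target hM (hΓM _ _), sq_abs]
  simp only [hblock]
  rw [integral_const_mul, integral_finsetSum (f := fun (j : Fin q) (x : P.U0 × (Fin q → P.Q)) =>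
    |Γ x.1 (x.2 j) - P.target x.1 (x.2 j)| ^ 2) _
    fun j _ => (hmp j).integrable_comp_of_integrable hint]
  simp only [hj, Finset.sum_const, Finset.card_univ, Fintype.card_fin, nsmul_eq_mul]
  field_simp

/-- Oracle inequality: with probability at least `1 - ρ`, every predictor `Γ b` whose empirical
risk is at most that of `Γ b₀` has population risk at most that of `Γ b₀` plus the entropy term. -/
lemma exists_oracle_event {ι : Type*} {n : ℕ} (hn : 1 ≤ n) (hq : 1 ≤ q)
    {Γ : ι → P.U0 → P.Q → ℝ} (hΓ : ∀ b, Measurable fun p : P.U0 × P.Q => Γ b p.1 p.2)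
    (hΓM : ∀ b u z, |Γ b u z| ≤ M) (b₀ : ι) {κ : ℝ} (hκ : 1 ≤ κ) {h : ℝ → ℝ}
    (hnet : ∀ ε, 0 < ε → ε ≤ 2 * M → ∃ N : Finset ι,
      (∀ b, ∃ s ∈ N, ∀ u z, |Γ b u z - Γ s u z| ≤ κ * ε) ∧
      ∀ ε', 0 < ε' → ε' ≤ ε → Real.log N.card ≤ h ε')
    (hJ : ∫⁻ ε in Ioc 0 (2 * M), ENNReal.ofReal (√(h ε)) ≠ ⊤) {ρ : ℝ} (hρ : 0 < ρ) (hρ1 : ρ < 1) :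
    ∃ G : Set (Fin n → P.U0 × (Fin q → P.Q)), MeasurableSet G ∧
      ENNReal.ofReal (1 - ρ) ≤ P.sampleLaw n q G ∧
      ∀ S ∈ G, ∀ b, P.empiricalRisk S (Γ b) ≤ P.empiricalRisk S (Γ b₀) →
        P.risk (Γ b) ≤ P.risk (Γ b₀) + 80 * κ * (M ^ 2 / √n +
          M * (∫⁻ ε in Ioc 0 (2 * M), ENNReal.ofReal (√(h ε))).toReal / √n +
          M ^ 2 * √(Real.log (1 / ρ) / n)) := by
  have hmeas := fun b => P.measurable_blockLoss (q := q) hM hδ hδ1 hC (hΓ b)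
  -- The target has zero loss, so the Lipschitz bound against it bounds the loss itself and yields
  -- integrability.
  have h0 : ∀ x : P.U0 × (Fin q → P.Q), |P.blockLoss P.target x| ≤ 0 := fun x => by
    simp [blockLoss, clippedLoss]
  have hbound : ∀ b (x : P.U0 × (Fin q → P.Q)), ‖P.blockLoss (Γ b) x‖ ≤ 4 * M * (2 * M) := by
    intro b x
    have h1 := P.abs_blockLoss_sub_le hM hq (hΓM b) (P.abs_target_le hM) (ε := 2 * M)
      (fun u z => (abs_sub _ _).trans (by linarith [hΓM b u z, P.abs_target_le hM u z])) x
    rwa [abs_nonpos_iff.1 (h0 x), sub_zero] at h1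
  obtain ⟨G, hG, hGρ, hdev⟩ := exists_uniform_deviation_event
    (μ := P.Pi.prod (Measure.pi fun _ : Fin q => P.mu)) hn
    (f := fun b => P.blockLoss (Γ b)) hmeas
    (fun b => Integrable.of_bound (hmeas b).aestronglyMeasurable _ (ae_of_all _ (hbound b))) b₀ hM hκ
    (h := h)
    (fun b x => (P.abs_blockLoss_sub_le hM hq (hΓM b) (hΓM b₀) (ε := 2 * M)
      (fun u z => (abs_sub _ _).trans (by linarith [hΓM b u z, hΓM b₀ u z])) x).trans_eq (by ring))
    (fun ε hε hε2 => by
      obtain ⟨N, hN, hNh⟩ := hnet ε hε hε2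
      refine ⟨N, fun b => ?_, hNh⟩
      obtain ⟨s, hs, hbs⟩ := hN b
      exact ⟨s, hs, fun x => (P.abs_blockLoss_sub_le hM hq (hΓM b) (hΓM s) hbs x).trans_eq
        (by ring)⟩) hJ hρ hρ1
  refine ⟨G, hG, hGρ, fun S hS b hb => ?_⟩
  have h1 := hdev S hS b
  -- The mean part of each deviation is the risk and the average part is the empirical risk; the
  -- empirical parts are then compared through `hb`.
  simp only [deviation, P.integral_blockLoss hM hδ hδ1 hC hq (hΓ _) (hΓM _)] at h1
  simp only [empiricalRisk] at hb
  simp only [blockLoss] at h1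
  linarith

end Setting

/-! ### Truncation depth and the full-information bound -/

lemma pow_depth_sq_le {δ : ℝ} (hδ : 0 < δ) (hδ1 : δ < 1) {n : ℕ} (hn : 1 ≤ n) :
    (δ ^ depth δ n) ^ 2 ≤ 1 / √n := by
  have hn' : (0 : ℝ) < n := by exact_mod_cast hn
  have hlog : Real.log δ < 0 := Real.log_neg hδ hδ1
  have h1 : Real.log n / (4 * |Real.log δ|) ≤ depth δ n := Nat.le_ceil _
  rw [abs_of_neg hlog, div_le_iff₀ (by linarith)] at h1
  -- In logarithms the claim is `2 * ℓ * log δ ≤ -(log n) / 2`, which is what the ceiling in `depth`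
  -- guarantees.
  rw [← Real.log_le_log_iff (by positivity) (by positivity), Real.log_pow, Real.log_pow, one_div,
    Real.log_inv, Real.log_sqrt hn'.le]
  push_cast
  linarith

namespace Setting

variable {M C_S δ : ℝ} (P : Setting M C_S δ)

lemma risk_model_star_le (hδ : 0 < δ) (hδ1 : δ < 1) (hM : 0 < M) {n : ℕ} (hn : 1 ≤ n) :
    P.risk (P.onU0 (P.model P.ωstar (depth δ n))) ≤ M ^ 2 / √n := by
  refine P.risk_le_of_sq_le fun u z => ?_
  calc _ ≤ (δ ^ depth δ n * M) ^ 2 := by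
        gcongr
        exact P.abs_model_sub_target_le hδ hδ1 hM _ u z
    _ = (δ ^ depth δ n) ^ 2 * M ^ 2 := by ring
    _ ≤ 1 / √n * M ^ 2 := by
        gcongr
        exact pow_depth_sq_le hδ hδ1 hn
    _ = _ := by ring

lemma abs_opEval_le (Γ : P.U0 → P.UM) (u : P.U0) (z : P.Q) : |P.opEval Γ u z| ≤ M :=
  (SpaceTimeFun.abs_eval_le _ _).trans (mem_closedBall_zero_iff.1 (Γ u).2)

lemma risk_embed_le (hM : 0 < M) {ℓ : ℕ} {𝔑 : Set (P.U0 → P.UM)} (embed : P.picardClass ℓ → 𝔑)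
    (b : P.picardClass ℓ) :
    P.risk (P.opEval (embed b).1) ≤ P.impError embed + P.risk (P.onU0 b.1) := by
  -- A real supremum bounds its terms only when the family is bounded; here both risks lie in `[0, 4
  -- * M ^ 2]`.
  have hbdd : BddAbove (range fun b : P.picardClass ℓ =>
      |P.risk (P.opEval (embed b).1) - P.risk (P.onU0 b.1)|) := by
    refine ⟨4 * M ^ 2, ?_⟩
    rintro _ ⟨b, rfl⟩
    obtain ⟨ω, hω, hb⟩ := b.2
    have h1 := P.risk_le hM (P.abs_opEval_le (embed b).1)
    have h2 : P.risk (P.onU0 b.1) ≤ 4 * M ^ 2 := P.risk_le hM fun u z => by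
      rw [hb]
      exact P.abs_model_le hM hω ℓ _ z
    have h3 := P.risk_nonneg (P.opEval (embed b).1)
    have h4 := P.risk_nonneg (P.onU0 b.1)
    exact abs_le.2 ⟨by linarith, by linarith⟩
  have h := le_ciSup hbdd b
  have h' := le_abs_self (P.risk (P.opEval (embed b).1) - P.risk (P.onU0 b.1))
  unfold impError
  linarith

lemma SpecEntropyBound.exists_cover {P : Setting M C_S δ} {H : ℝ → ℝ} (hH : P.SpecEntropyBound H)
    {ε : ℝ} (hε : 0 < ε) :
    ∃ N : Finset P.Ω,
      (∀ ω : P.Ω, ∃ s ∈ N, (specPseudoEMetric P.D P.T P.R M).edist ω.1 s.1 ≤ ENNReal.ofReal ε) ∧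
      ∀ ε', 0 < ε' → ε' ≤ ε → Real.log N.card ≤ H ε' :=
  letI := specPseudoEMetric P.D P.T P.R M
  exists_finset_cover_of_entropy_le hH hε

lemma exists_full_information_event {c : ℝ} (hc : 0 < c) (hδ : 0 < δ) (hδ1 : δ < 1) (hM : 0 < M)
    (hC : 0 ≤ C_S) {H : ℝ → ℝ} (hH : P.SpecEntropyBound H) (hI : entropyIntegral M δ c H < ⊤)
    {n q : ℕ} (hn : 1 ≤ n) (hq : 1 ≤ q) {𝔑 : Set (P.U0 → P.UM)}
    (embed : P.picardClass (depth δ n) → 𝔑) {ρ : ℝ} (hρ : 0 < ρ) (hρ1 : ρ < 1) :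
    ∃ G : Set (Fin n → P.U0 × (Fin q → P.Q)), MeasurableSet G ∧
      ENNReal.ofReal (1 - ρ) ≤ P.sampleLaw n q G ∧
      ∀ S ∈ G, ∀ bhat : P.picardClass (depth δ n), P.IsERM S bhat →
        P.risk (P.opEval (embed bhat).1) ≤ P.impError embed +
          (80 * max 1 c + 1) * (M ^ 2 / √n + M * (entropyIntegral M δ c H).toReal / √n +
            M ^ 2 * √(Real.log (1 / ρ) / n)) := by
  have hδ' : 0 < 1 - δ := by linarith
  obtain ⟨G, hG, hGρ, hrisk⟩ := P.exists_oracle_event hM hδ hδ1 hC hn hq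
    -- The class is indexed by equations rather than predictors, so nets of `Ω` can be used
    -- directly. A `c * (1 - δ) * ε`-net of equations gives a `c * ε`-net of predictors, hence `κ =
    -- max 1 c`.
    (Γ := fun ω : P.Ω => P.onU0 (P.model ω.1 (depth δ n)))
    (fun ω => P.measurable_model hδ hδ1 hM hC ω.2 _)
    (fun ω u z => P.abs_model_le hM ω.2 _ _ z) ⟨P.ωstar, P.ωstar_mem⟩ (le_max_left 1 c)
    (h := fun ε => H (c * (1 - δ) * ε))
    (fun ε hε _ => by
      obtain ⟨N, hN, hNH⟩ := hH.exists_cover (ε := c * (1 - δ) * ε) (by positivity)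
      refine ⟨N, fun ω => ?_, fun ε' hε' hle => hNH _ (by positivity) (by gcongr)⟩
      obtain ⟨s, hs, hωs⟩ := hN ω
      refine ⟨s, hs, fun u z => (P.abs_model_sub_model_le_of_edist_le hδ hδ1 hM ω.2 s.2
        (by positivity) hωs _ _ z).trans ?_⟩
      calc c * (1 - δ) * ε / (1 - δ) = c * ε := by field_simp
        _ ≤ _ := by
          gcongr
          exact le_max_right _ _) hI.ne hρ hρ1
  refine ⟨G, hG, hGρ, fun S hS bhat hbhat => ?_⟩
  obtain ⟨ω, hω, hb⟩ := bhat.2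
  have h1 := hrisk S hS ⟨ω, hω⟩ (by
    simpa only [hb] using hbhat ⟨_, P.ωstar, P.ωstar_mem, rfl⟩)
  have h2 := P.risk_embed_le hM embed bhat
  rw [hb] at h2
  -- The bias of the comparison model accounts for the extra `1` in the constant.
  have h3 := P.risk_model_star_le hδ hδ1 hM hn
  have h4 : 0 ≤ M * (entropyIntegral M δ c H).toReal / √n := by positivity
  have h5 : 0 ≤ M ^ 2 * √(Real.log (1 / ρ) / n) := by positivity
  rw [entropyIntegral] at h4 ⊢
  linarith

end Setting

/-! ### Finite observations -/

namespace Sensing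

variable {M C_S δ : ℝ} {P : Setting M C_S δ} (O : Sensing P)

/-- The observation `a` stays fixed along the iteration, so this is the full-information model at
the reconstructed datum `E a`; all stability bounds carry over. -/
lemma model_eq {m : ℕ} (ω : EquationSpec P.D) (E : (Fin m → ℝ) → P.U0) (ℓ : ℕ) (a : Fin m → ℝ)
    (z : P.Q) : model ω E ℓ a z = P.model ω ℓ (P.incl (E a)) z := by
  have : ∀ ℓ, (step ω E)^[ℓ] (a, z, 0) = (a, z, (picardMap ω (E a).1)^[ℓ] 0) := by
    intro ℓ
    induction ℓ with
    | zero => rfl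
    | succ ℓ ih => simp only [Function.iterate_succ_apply', ih, step]
  simp only [model, this, P.model_eq]
  rfl

lemma measurable_obs (m : ℕ) : Measurable (O.obs m) := by
  refine measurable_pi_iff.2 fun i => ?_
  unfold obs
  have : Continuous fun u : P.U0 => u.1 (O.ξ m i) := by fun_prop
  exact this.measurable

lemma risk_embed_le (hM : 0 < M) {m ℓ : ℕ} {𝔑 : Set ((Fin m → ℝ) → P.Q → ℝ)}
    (h𝔑 : ∀ Γ ∈ 𝔑, ∀ a z, |Γ a z| ≤ M) (embed : O.picardClass m ℓ → 𝔑)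
    (b : O.picardClass m ℓ) :
    O.risk (embed b).1 ≤ O.impError embed + O.risk b.1 := by
  have hbdd : BddAbove (range fun b : O.picardClass m ℓ =>
      |O.risk (embed b).1 - O.risk b.1|) := by
    refine ⟨4 * M ^ 2, ?_⟩
    rintro _ ⟨b, rfl⟩
    obtain ⟨ω, hω, E, hE, hb⟩ := b.2
    have h1 : O.risk (embed b).1 ≤ 4 * M ^ 2 := P.risk_le hM fun u z => h𝔑 _ (embed b).2 _ z
    have h2 : O.risk b.1 ≤ 4 * M ^ 2 := P.risk_le hM fun u z => by
      rw [hb, lift, model_eq]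
      exact P.abs_model_le hM hω ℓ _ z
    have h3 : 0 ≤ O.risk (embed b).1 := P.risk_nonneg _
    have h4 : 0 ≤ O.risk b.1 := P.risk_nonneg _
    exact abs_le.2 ⟨by linarith, by linarith⟩
  have h := le_ciSup hbdd b
  have h' := le_abs_self (O.risk (embed b).1 - O.risk b.1)
  unfold impError
  linarith

lemma ReconEntropyBound.exists_cover {O : Sensing P} {m : ℕ} {H : ℝ → ℝ}
    (hH : O.ReconEntropyBound m H) {ε : ℝ} (hε : 0 < ε) :
    ∃ N : Finset (O.recon m),
      (∀ E : O.recon m, ∃ s ∈ N, (O.reconPseudoEMetric m).edist E.1 s.1 ≤ ENNReal.ofReal ε) ∧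
      ∀ ε', 0 < ε' → ε' ≤ ε → Real.log N.card ≤ H ε' :=
  letI := O.reconPseudoEMetric m
  exists_finset_cover_of_entropy_le hH hε

variable (hδ : 0 < δ) (hδ1 : δ < 1) (hM : 0 < M) (hC : 0 < C_S)

include hδ hδ1 hM hC

/-- The equation is changed first, then the datum, each at a cost of at most `ε`. Dividing by `C_S`
in the second hypothesis cancels the Lipschitz constant. -/
lemma abs_model_sub_model_le {m : ℕ} {ω ω' : EquationSpec P.D} {E E' : (Fin m → ℝ) → P.U0}
    (hω : ω ∈ P.Ω) (hω' : ω' ∈ P.Ω) {ε : ℝ} (hε : 0 ≤ ε)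
    (h : (specPseudoEMetric P.D P.T P.R M).edist ω ω' ≤ ENNReal.ofReal ((1 - δ) * ε))
    (h' : (O.reconPseudoEMetric m).edist E E' ≤ ENNReal.ofReal ((1 - δ) * ε / C_S)) (ℓ : ℕ)
    (u : P.U0) (z : P.Q) :
    |O.lift (model ω E ℓ) u z - O.lift (model ω' E' ℓ) u z| ≤ 2 * ε := by
  have hδ' : 0 < 1 - δ := by linarith
  simp only [lift, model_eq]
  have h1 := P.abs_model_sub_model_le_of_edist_le hδ hδ1 hM hω hω' (by positivity) h ℓ
    (P.incl (E (O.obs m u))) z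
  have h2 := P.abs_model_sub_model_le hδ hδ1 hM hC.le hω' ℓ (P.incl (E (O.obs m u)))
    (P.incl (E' (O.obs m u))) z
  have h3 : ‖(P.incl (E (O.obs m u))).1 - (P.incl (E' (O.obs m u))).1‖ ≤ (1 - δ) * ε / C_S := by
    have h4 := (le_iSup (fun u : P.U0 => edist (E (O.obs m u)).1 (E' (O.obs m u)).1) u).trans h'
    rw [← dist_eq_norm]
    exact (edist_le_ofReal (by positivity)).1 h4
  have h5 : (1 - δ) * ε / (1 - δ) = ε := by field_simp
  have h6 : C_S * ‖(P.incl (E (O.obs m u))).1 - (P.incl (E' (O.obs m u))).1‖ / (1 - δ) ≤ ε := by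
    calc _ ≤ C_S * ((1 - δ) * ε / C_S) / (1 - δ) := by gcongr
      _ = ε := by field_simp
  have h7 := abs_sub_le (P.model ω ℓ (P.incl (E (O.obs m u))) z)
    (P.model ω' ℓ (P.incl (E (O.obs m u))) z) (P.model ω' ℓ (P.incl (E' (O.obs m u))) z)
  linarith

lemma measurable_lift_model {m : ℕ} {ω : EquationSpec P.D} {E : (Fin m → ℝ) → P.U0}
    (hω : ω ∈ P.Ω) (hE : E ∈ O.recon m) (ℓ : ℕ) :
    Measurable fun p : P.U0 × P.Q => O.lift (model ω E ℓ) p.1 p.2 := by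
  simp only [lift, model_eq]
  exact (P.measurable_model hδ hδ1 hM hC.le hω ℓ).comp
    ((((O.measurable_recon m E hE).comp (O.measurable_obs m)).comp measurable_fst).prodMk
      measurable_snd)

/-- The risk of the true Picard model after reconstruction is controlled by the reconstruction
error and the truncation error. -/
lemma risk_model_star_le {m n : ℕ} (hn : 1 ≤ n) {E : (Fin m → ℝ) → P.U0} (hE : E ∈ O.recon m)
    {B : ℝ} (hB : 0 ≤ B)
    (hrec : ∫⁻ u, ‖(E (O.obs m u)).1 - u.1‖ₑ ^ 2 ∂P.Pi ≤ ENNReal.ofReal B) :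
    O.risk (model P.ωstar E (depth δ n)) ≤ 2 * (C_S / (1 - δ)) ^ 2 * B + 2 * (M ^ 2 / √n) := by
  have hδ' : 0 < 1 - δ := by linarith
  set ℓ := depth δ n
  have hpt : ∀ u z, |O.lift (model P.ωstar E ℓ) u z - P.target u z| ^ 2 ≤
      2 * (C_S / (1 - δ)) ^ 2 * ‖(E (O.obs m u)).1 - u.1‖ ^ 2 + 2 * (M ^ 2 / √n) := by
    intro u z
    simp only [lift, model_eq]
    have h1 := P.abs_model_sub_model_le hδ hδ1 hM hC.le P.ωstar_mem ℓ (P.incl (E (O.obs m u)))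
      (P.incl u) z
    have h2 := P.abs_model_sub_target_le hδ hδ1 hM ℓ u z
    have h3 := (abs_sub_le (P.model P.ωstar ℓ (P.incl (E (O.obs m u))) z)
      (P.model P.ωstar ℓ (P.incl u) z) (P.target u z)).trans (add_le_add h1 h2)
    have h4 : (δ ^ ℓ * M) ^ 2 ≤ M ^ 2 / √n := by
      calc _ = (δ ^ ℓ) ^ 2 * M ^ 2 := by ring
        _ ≤ 1 / √n * M ^ 2 := by
          gcongr
          exact pow_depth_sq_le hδ hδ1 hn
        _ = _ := by ring
    calc _ ≤ (C_S * ‖(E (O.obs m u)).1 - u.1‖ / (1 - δ) + δ ^ ℓ * M) ^ 2 := by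
          gcongr
          exact h3
      _ ≤ 2 * ((C_S * ‖(E (O.obs m u)).1 - u.1‖ / (1 - δ)) ^ 2 + (δ ^ ℓ * M) ^ 2) := add_sq_le
      _ = 2 * (C_S / (1 - δ)) ^ 2 * ‖(E (O.obs m u)).1 - u.1‖ ^ 2 + 2 * (δ ^ ℓ * M) ^ 2 := by ring
      _ ≤ _ := by gcongr
  have hmodel := O.measurable_lift_model hδ hδ1 hM hC P.ωstar_mem hE ℓ
  have ht := P.measurable_target hδ hδ1 hM hC.le
  have hmeas : Measurable fun p : P.U0 × P.Q =>
      |O.lift (model P.ωstar E ℓ) p.1 p.2 - P.target p.1 p.2| ^ 2 := by fun_prop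
  have hA : 0 ≤ 2 * (C_S / (1 - δ)) ^ 2 := by positivity
  -- The comparison uses lower integrals, as `recError` does, so that no integrability of the
  -- squared reconstruction error has to be shown.
  have hle : ENNReal.ofReal (O.risk (model P.ωstar E ℓ)) ≤
      ENNReal.ofReal (2 * (C_S / (1 - δ)) ^ 2 * B + 2 * (M ^ 2 / √n)) := by
    have hint : Integrable (fun p : P.U0 × P.Q =>
        |O.lift (model P.ωstar E ℓ) p.1 p.2 - P.target p.1 p.2| ^ 2) (P.Pi.prod P.mu) := by
      refine Integrable.of_bound hmeas.aestronglyMeasurable (4 * M ^ 2) (ae_of_all _ fun p => ?_)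
      rw [Real.norm_of_nonneg (by positivity), lift, model_eq]
      exact P.sq_sub_target_le hM (P.abs_model_le hM P.ωstar_mem _ _ _) _ _
    rw [risk, Setting.risk, ofReal_integral_eq_lintegral_ofReal hint
      (ae_of_all _ fun _ => by positivity), lintegral_prod _ hmeas.ennreal_ofReal.aemeasurable]
    calc _ ≤ ∫⁻ u, (ENNReal.ofReal (2 * (C_S / (1 - δ)) ^ 2) * ‖(E (O.obs m u)).1 - u.1‖ₑ ^ 2 +
          ENNReal.ofReal (2 * (M ^ 2 / √n))) ∂P.Pi := by
          refine lintegral_mono fun u => ?_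
          refine (lintegral_mono (g := fun _ => _) fun z => ENNReal.ofReal_le_ofReal
            (hpt u z)).trans_eq ?_
          rw [lintegral_const, measure_univ, mul_one, ENNReal.ofReal_add (by positivity)
            (by positivity), ENNReal.ofReal_mul hA, ENNReal.ofReal_pow (norm_nonneg _),
            ofReal_norm]
      _ = ENNReal.ofReal (2 * (C_S / (1 - δ)) ^ 2) *
            ∫⁻ u, ‖(E (O.obs m u)).1 - u.1‖ₑ ^ 2 ∂P.Pi + ENNReal.ofReal (2 * (M ^ 2 / √n)) := by
          rw [lintegral_add_right _ measurable_const, lintegral_const_mul' _ _ ENNReal.ofReal_ne_top,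
            lintegral_const, measure_univ, mul_one]
      _ ≤ ENNReal.ofReal (2 * (C_S / (1 - δ)) ^ 2) * ENNReal.ofReal B +
            ENNReal.ofReal (2 * (M ^ 2 / √n)) := by gcongr
      _ = _ := by
          rw [← ENNReal.ofReal_mul hA, ENNReal.ofReal_add (by positivity) (by positivity)]
  exact (ENNReal.ofReal_le_ofReal_iff (by positivity)).1 hle

lemma exists_finite_observation_event {c : ℝ} (hc : 0 < c) {H H' : ℝ → ℝ}
    (hH : P.SpecEntropyBound H) {m : ℕ} (hH' : O.ReconEntropyBound m H')
    (hI : entropyIntegralObs M C_S δ c H H' ≠ ⊤) {B : ℝ} (hB : 0 ≤ B)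
    (hrec : O.recError m < ENNReal.ofReal B) {n q : ℕ} (hn : 1 ≤ n) (hq : 1 ≤ q)
    {𝔑 : Set ((Fin m → ℝ) → P.Q → ℝ)} (h𝔑 : ∀ Γ ∈ 𝔑, ∀ a z, |Γ a z| ≤ M)
    (embed : O.picardClass m (depth δ n) → 𝔑) {ρ : ℝ} (hρ : 0 < ρ) (hρ1 : ρ < 1) :
    ∃ G : Set (Fin n → P.U0 × (Fin q → P.Q)), MeasurableSet G ∧
      ENNReal.ofReal (1 - ρ) ≤ P.sampleLaw n q G ∧
      ∀ S ∈ G, ∀ bhat : O.picardClass m (depth δ n), O.IsERM S bhat →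
        O.risk (embed bhat).1 ≤ O.impError embed +
          (2 * (C_S / (1 - δ)) ^ 2 * B + 2 * (M ^ 2 / √n) +
          80 * max 1 (2 * c) * (M ^ 2 / √n +
            M * (entropyIntegralObs M C_S δ c H H').toReal / √n +
            M ^ 2 * √(Real.log (1 / ρ) / n))) := by
  have hδ' : 0 < 1 - δ := by linarith
  -- The infimum need not be attained; the strict inequality in `hrec` provides an admissible map.
  obtain ⟨E₀, hE₀, hE₀rec⟩ : ∃ E₀ ∈ O.recon m,
      ∫⁻ u, ‖(E₀ (O.obs m u)).1 - u.1‖ₑ ^ 2 ∂P.Pi < ENNReal.ofReal B := by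
    simpa only [recError, iInf_lt_iff, exists_prop] using hrec
  obtain ⟨G, hG, hGρ, hrisk⟩ := P.exists_oracle_event hM hδ hδ1 hC.le hn hq
    (Γ := fun x : P.Ω × O.recon m => O.lift (model x.1.1 x.2.1 (depth δ n)))
    (fun x => O.measurable_lift_model hδ hδ1 hM hC x.1.2 x.2.2 _)
    (fun x u z => by
      rw [lift, model_eq]
      exact P.abs_model_le hM x.1.2 _ _ z)
    (⟨P.ωstar, P.ωstar_mem⟩, ⟨E₀, hE₀⟩) (le_max_left 1 (2 * c))
    (h := fun ε => H (c * (1 - δ) * ε) + H' (c * (1 - δ) * ε / C_S))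
    (fun ε hε _ => by
      obtain ⟨N, hN, hNH⟩ := hH.exists_cover (ε := c * (1 - δ) * ε) (by positivity)
      obtain ⟨N', hN', hNH'⟩ := hH'.exists_cover (ε := c * (1 - δ) * ε / C_S) (by positivity)
      -- Product nets make log-cardinalities add, giving the sum under the root. The two
      -- perturbations cost `c * ε` each, hence `2 * c` in the constant.
      refine ⟨N ×ˢ N', fun x => ?_, fun ε' hε' hle => ?_⟩
      · obtain ⟨s, hs, hωs⟩ := hN x.1
        obtain ⟨s', hs', hEs⟩ := hN' x.2
        refine ⟨(s, s'), Finset.mk_mem_product hs hs', fun u z => ?_⟩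
        have heq : c * (1 - δ) * ε = (1 - δ) * (c * ε) := by ring
        rw [heq] at hωs hEs
        refine (O.abs_model_sub_model_le hδ hδ1 hM hC x.1.2 s.2 (by positivity) hωs hEs _ u
          z).trans ?_
        rw [← mul_assoc]
        gcongr
        exact le_max_right _ _
      · have h1 : N.Nonempty := let ⟨s, hs, _⟩ := hN ⟨P.ωstar, P.ωstar_mem⟩; ⟨s, hs⟩
        have h2 : N'.Nonempty := let ⟨s, hs, _⟩ := hN' ⟨E₀, hE₀⟩; ⟨s, hs⟩
        rw [Finset.card_product, Nat.cast_mul, Real.log_mul (by simpa using h1.ne_empty)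
          (by simpa using h2.ne_empty)]
        exact add_le_add (hNH _ (by positivity) (by gcongr)) (hNH' _ (by positivity) (by gcongr)))
    hI hρ hρ1
  refine ⟨G, hG, hGρ, fun S hS bhat hbhat => ?_⟩
  obtain ⟨ω, hω, E, hE, hb⟩ := bhat.2
  have h1 := hrisk S hS (⟨ω, hω⟩, ⟨E, hE⟩) (by
    simpa only [hb] using hbhat ⟨_, P.ωstar, P.ωstar_mem, E₀, hE₀, rfl⟩)
  have h2 := O.risk_embed_le hM h𝔑 embed bhat
  rw [hb] at h2
  have h3 := O.risk_model_star_le hδ hδ1 hM hC hn hE₀ hB hE₀rec.le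
  rw [entropyIntegralObs]
  simp only [risk] at h2 h3 ⊢
  linarith

end Sensing

/-! ### Balancing the number of sensors -/

section Rates

variable {α β κ₁ κ₂ : ℝ} {m n : ℕ}

lemma rpow_sensors_le_rate (hα : 0 ≤ α) (hβ : 0 < β) (hκ₁ : 0 < κ₁) (hn : 1 ≤ n)
    (hm : κ₁ * (n : ℝ) ^ (1 / (2 * (2 * β + α))) ≤ m) :
    (m : ℝ) ^ (-(2 * β)) ≤ κ₁ ^ (-(2 * β)) * (n : ℝ) ^ (-(β / (2 * β + α))) := by
  have hn' : (0 : ℝ) < n := by exact_mod_cast hn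
  have hγ : 0 < 2 * β + α := by linarith
  calc (m : ℝ) ^ (-(2 * β)) ≤ (κ₁ * (n : ℝ) ^ (1 / (2 * (2 * β + α)))) ^ (-(2 * β)) :=
        Real.rpow_le_rpow_of_nonpos (by positivity) hm (by linarith)
    _ = _ := by
        rw [Real.mul_rpow hκ₁.le (by positivity), ← Real.rpow_mul hn'.le]
        congr 2
        field_simp

/-- The exponent `α / (2 * (2 * β + α)) - 1 / 2` equals `-(β / (2 * β + α))`, the same rate as for
the reconstruction error. The absolute value spares a sign condition on `κ₂`. -/
lemma rpow_sensors_div_sqrt_le_rate (hα : 0 ≤ α) (hβ : 0 < β) (hn : 1 ≤ n)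
    (hm : (m : ℝ) ≤ κ₂ * (n : ℝ) ^ (1 / (2 * (2 * β + α)))) :
    (m : ℝ) ^ α / √n ≤ |κ₂| ^ α * (n : ℝ) ^ (-(β / (2 * β + α))) := by
  have hn' : (0 : ℝ) < n := by exact_mod_cast hn
  have hγ : 0 < 2 * β + α := by linarith
  calc (m : ℝ) ^ α / √n ≤ (|κ₂| * (n : ℝ) ^ (1 / (2 * (2 * β + α)))) ^ α / √n := by
        gcongr
        exact hm.trans (by gcongr; exact le_abs_self _)
    _ = |κ₂| ^ α * (n : ℝ) ^ (1 / (2 * (2 * β + α)) * α - 1 / 2) := by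
        rw [Real.mul_rpow (abs_nonneg _) (by positivity), ← Real.rpow_mul hn'.le,
          Real.rpow_sub hn', Real.sqrt_eq_rpow, mul_div_assoc]
    _ = _ := by
        congr 2
        field_simp
        ring

lemma one_div_sqrt_le_rate (hα : 0 ≤ α) (hβ : 0 < β) (hn : 1 ≤ n) :
    1 / √(n : ℝ) ≤ (n : ℝ) ^ (-(β / (2 * β + α))) := by
  have hγ : 0 < 2 * β + α := by linarith
  rw [Real.sqrt_eq_rpow, one_div, ← Real.rpow_neg (by positivity)]
  refine Real.rpow_le_rpow_of_exponent_le (by exact_mod_cast hn) (neg_le_neg ?_)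
  rw [div_le_div_iff₀ hγ two_pos]
  linarith

end Rates

end PicardLearning

/-! ### The two risk bounds -/

open PicardLearning in
theorem corollary5p3 :
    -- full information: the constant depends only on `c` and `δ`
    (∀ c δ : ℝ, 0 < c → 0 < δ → δ < 1 →
      ∃ C : ℝ, 0 < C ∧
        ∀ M C_S : ℝ, 0 < M → 0 < C_S →
        ∀ (P : Setting M C_S δ) (H : ℝ → ℝ), P.SpecEntropyBound H →
        entropyIntegral M δ c H < ⊤ →
        ∀ n q : ℕ, 1 ≤ n → 1 ≤ q →
        ∀ 𝔑 : Set (P.U0 → P.UM),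
        (∀ Γ ∈ 𝔑, Measurable fun p : P.U0 × P.Q => P.opEval Γ p.1 p.2) →
        ∀ embed : P.picardClass (depth δ n) → 𝔑,
        ∀ ρ : ℝ, 0 < ρ → ρ < 1 →
        ∃ G : Set (Fin n → P.U0 × (Fin q → P.Q)), MeasurableSet G ∧
          ENNReal.ofReal (1 - ρ) ≤ P.sampleLaw n q G ∧
          ∀ S ∈ G, ∀ bhat : P.picardClass (depth δ n), P.IsERM S bhat →
            P.risk (P.opEval (embed bhat).1) ≤ P.impError embed +
              C * (M ^ 2 / √n + M * (entropyIntegral M δ c H).toReal / √n +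
                M ^ 2 * √(Real.log (1 / ρ) / n))) ∧
    -- finite observations
    (∀ c δ M C_S C_rec C_I α β κ₁ κ₂ : ℝ, 0 < c → 0 < δ → δ < 1 → 0 < M → 0 < C_S →
      0 < C_I → 0 ≤ α → 0 < β → 0 < κ₁ →
      ∃ C : ℝ, 0 < C ∧
        ∀ (P : Setting M C_S δ) (O : Sensing P) (H : ℝ → ℝ) (H' : ℕ → ℝ → ℝ),
        P.SpecEntropyBound H → (∀ m, 1 ≤ m → O.ReconEntropyBound m (H' m)) →
        (∀ m : ℕ, 1 ≤ m →
          entropyIntegralObs M C_S δ c H (H' m) ≤ ENNReal.ofReal (C_I * (m : ℝ) ^ α)) →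
        (∀ m : ℕ, 1 ≤ m →
          O.recError m ≤ ENNReal.ofReal (C_rec ^ 2 * (m : ℝ) ^ (-(2 * β)))) →
        ∀ m : ℕ → ℕ,
        (∀ n : ℕ, 1 ≤ n → κ₁ * (n : ℝ) ^ (1 / (2 * (2 * β + α))) ≤ m n ∧
          (m n : ℝ) ≤ κ₂ * (n : ℝ) ^ (1 / (2 * (2 * β + α)))) →
        ∀ n q : ℕ, 1 ≤ n → 1 ≤ q →
        ∀ 𝔑 : Set ((Fin (m n) → ℝ) → P.Q → ℝ),
        (∀ Γ ∈ 𝔑, (Measurable fun p : (Fin (m n) → ℝ) × P.Q => Γ p.1 p.2) ∧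
          ∀ a z, |Γ a z| ≤ M) →
        ∀ embed : O.picardClass (m n) (depth δ n) → 𝔑,
        ∀ ρ : ℝ, 0 < ρ → ρ < 1 →
        ∃ G : Set (Fin n → P.U0 × (Fin q → P.Q)), MeasurableSet G ∧
          ENNReal.ofReal (1 - ρ) ≤ P.sampleLaw n q G ∧
          ∀ S ∈ G, ∀ bhat : O.picardClass (m n) (depth δ n), O.IsERM S bhat →
            O.risk (embed bhat).1 ≤ O.impError embed +
              C * ((n : ℝ) ^ (-(β / (2 * β + α))) + M ^ 2 * √(Real.log (1 / ρ) / n))) := by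
  refine ⟨fun c δ hc hδ hδ1 => ⟨80 * max 1 c + 1, by positivity, ?_⟩, ?_⟩
  · intro M C_S hM hC P H hH hI n q hn hq 𝔑 _ embed ρ hρ hρ1
    exact P.exists_full_information_event hc hδ hδ1 hM hC.le hH hI hn hq embed hρ hρ1
  intro c δ M C_S C_rec C_I α β κ₁ κ₂ hc hδ hδ1 hM hC hCI hα hβ hκ₁
  refine ⟨2 * (C_S / (1 - δ)) ^ 2 * (C_rec ^ 2 * κ₁ ^ (-(2 * β)) + 1) + 2 * M ^ 2 +
    80 * max 1 (2 * c) * (M ^ 2 + M * C_I * |κ₂| ^ α + 1), by positivity, ?_⟩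
  intro P O H H' hH hH' hI hrec m hm n q hn hq 𝔑 h𝔑 embed ρ hρ hρ1
  have hn' : (0 : ℝ) < n := by exact_mod_cast hn
  have hm1 : 1 ≤ m n := by
    have : (0 : ℝ) < m n := lt_of_lt_of_le (by positivity) (hm n hn).1
    exact_mod_cast this
  have hm0 : (0 : ℝ) < m n := by exact_mod_cast hm1
  set r : ℝ := (n : ℝ) ^ (-(β / (2 * β + α))) with hr
  have hr0 : 0 < r := by positivity
  have hIm := hI (m n) hm1
  obtain ⟨G, hG, hGρ, hrisk⟩ := O.exists_finite_observation_event hδ hδ1 hM hC hc hH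
    (hH' (m n) hm1) (ne_top_of_le_ne_top ENNReal.ofReal_ne_top hIm)
    -- Adding the target rate `r` makes the bound on the reconstruction error strict even if `C_rec
    -- = 0`; it costs only the `+ 1` beside `C_rec ^ 2 * κ₁ ^ (-(2 * β))`.
    (B := C_rec ^ 2 * (m n : ℝ) ^ (-(2 * β)) + r) (by positivity)
    ((hrec (m n) hm1).trans_lt ((ENNReal.ofReal_lt_ofReal_iff (by positivity)).2 (by linarith)))
    hn hq (fun Γ hΓ => (h𝔑 Γ hΓ).2) embed hρ hρ1
  refine ⟨G, hG, hGρ, fun S hS bhat hbhat => (hrisk S hS bhat hbhat).trans ?_⟩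
  have hrec_rate := rpow_sensors_le_rate hα hβ hκ₁ hn (hm n hn).1
  have hent_rate := rpow_sensors_div_sqrt_le_rate hα hβ hn (hm n hn).2
  have hsqrt_rate := one_div_sqrt_le_rate hα hβ hn
  rw [← hr] at hrec_rate hent_rate hsqrt_rate
  set t := M ^ 2 * √(Real.log (1 / ρ) / n)
  have ht : 0 ≤ t := by positivity
  set J := (entropyIntegralObs M C_S δ c H (H' (m n))).toReal
  have hJ : J ≤ C_I * (m n : ℝ) ^ α :=
    ENNReal.toReal_le_of_le_ofReal (by positivity) hIm
  have h1 : M ^ 2 / √n ≤ M ^ 2 * r := by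
    rw [div_eq_mul_one_div]
    gcongr
  have h2 : M * J / √n ≤ M * C_I * |κ₂| ^ α * r := by
    calc M * J / √n ≤ M * (C_I * (m n : ℝ) ^ α) / √n := by gcongr
      _ = M * C_I * ((m n : ℝ) ^ α / √n) := by ring
      _ ≤ M * C_I * (|κ₂| ^ α * r) := by gcongr
      _ = _ := by ring
  have h3 : C_rec ^ 2 * (m n : ℝ) ^ (-(2 * β)) + r ≤ (C_rec ^ 2 * κ₁ ^ (-(2 * β)) + 1) * r := by
    calc _ ≤ C_rec ^ 2 * (κ₁ ^ (-(2 * β)) * r) + r := by gcongr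
      _ = _ := by ring
  set A := 2 * (C_S / (1 - δ)) ^ 2
  set κ := 80 * max 1 (2 * c)
  have hA : 0 ≤ A := by positivity
  have hκ : 0 ≤ κ := by positivity
  have hK : 0 ≤ A * (C_rec ^ 2 * κ₁ ^ (-(2 * β)) + 1) + 2 * M ^ 2 +
    κ * (M ^ 2 + M * C_I * |κ₂| ^ α) := by positivity
  gcongr O.impError embed + ?_
  calc _ ≤ A * ((C_rec ^ 2 * κ₁ ^ (-(2 * β)) + 1) * r) + 2 * (M ^ 2 * r) +
        κ * (M ^ 2 * r + M * C_I * |κ₂| ^ α * r + t) := by gcongr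
    -- The constant is the factor in `hK` plus `κ`; expanding its product with `r + t` leaves that
    -- factor times `t` and `κ * r` as nonnegative surplus.
    _ ≤ _ := by nlinarith [mul_nonneg hK ht, mul_nonneg hκ hr0.le]
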